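/- For spaces $X,Y$ let $[X,Y]$ be the set of homotopy classes of continuous maps $X\to Y$. For a set $X$ let $\langle X\rangle$ be the free abelian group with basis $\{\langle x\rangle : x\in X\}$; let $L(X,Y)\subseteq \mathrm{Hom}(\langle X\rangle,\langle Y\rangle)$ be the subgroup generated by the homomorphisms that send every $\langle x\rangle$ to some $\langle y\rangle$ or to $0$, and for a map $a:X\to Y$ let $\langle a\rangle\in L(X,Y)$ be given by $\langle x\rangle\mapsto\langle a(x)\rangle$. For an abelian group $M$, a map $f:[X,Y]\to M$ is called straight if there is a homomorphism $F:L(X,Y)\to M$ with $f([a])=F(\langle a\rangle)$ for all continuous $a:X\to Y$. Let $SX$ be the integral singular chain complex, $[SX,SY]$ the group of chain homotopy classes of morphisms $SX\to SY$, and let $h:[X,Y]\to[SX,SY]$, $[a]\mapsto[Sa]$, be the main invariant. A space is valid if it is homotopy equivalent to a CW-complex, and finitary if it is weakly homotopy equivalent to a compact CW-complex. Let $X$ be the one-point compactification of $(0,\infty)$ and let $Y$ (the Hawaiian ear-ring) be the one-point compactification of $(0,\infty)\setminus\mathbb N$. Let $m:X\to Y$ be the continuous map given by $m(x)=\lfloor\frac{x+1}{2}\rfloor+(-1)^{\lfloor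 x/2\rfloor}\{-x\}$ for $x\in(0,\infty)\setminus\mathbb N$ and $m(x)=\infty$ for all other $x$. For $i,j\in\{0,1\}$ let $r_{ij}:Y\to Y$ be the continuous map that fixes $\infty$ and sends $y\in(0,\infty)\setminus\mathbb N$ to $y_{(j)}$ if $\lfloor y\rfloor$ is odd and to $y_{(i)}$ if $\lfloor y\rfloor$ is even, where $y_{(0)}=y$ and $y_{(1)}=\infty$. Put $a_{ij}=r_{ij}\circ m$, and write $\bigvee_{ij}z_{ij}=z_{00}-z_{10}-z_{01}+z_{11}$. Let $e\in H_1(X)$ be the standard generator, that is, the class of the loop $[0,1]\to X$, $t\mapsto t/(1-t)$ for $0<t<1$, $0,1\mapsto\infty$. Then: 1. $X$ is homeomorphic to the circle, and it is valid and finitary. 2. The element $m_*(e)\in H_1(Y)$ has infinite order, and there is a homomorphism $k:H_1(Y)\to\mathbb Q$ with $k(m_*(e))=1$. 3. $\bigvee_{ij}\langle a_{ij}\rangle=0$ in $L(X,Y)$. 4. For every homomorphism $k:H_1(Y)\to\mathbb Q$ with $k(m_*(e))=1$, let $d:[SX,SY]\to\mathbb Q$ be the homomorphism $d([v])=k(v_*(e))$.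 Then $\bigvee_{ij}(d\circ h)([a_{ij}])=1\neq 0$, and the invariant $d\circ h:[X,Y]\to\mathbb Q$ is not straight. 5. The main invariant $h:[X,Y]\to[SX,SY]$ is not straight. Consequently, validity of the target cannot be dropped: neither of the following assertions holds for arbitrary spaces $X$, $Y$: (a) the main invariant $h:[X,Y]\to[SX,SY]$ is straight; (b) if $X$ is finitary and valid, $M$ is an abelian group and $f:[X,Y]\to M$ is a map, then $f$ is straight if and only if $f=d\circ h$ for some homomorphism $d:[SX,SY]\to M$. -/

import Mathlib

open CategoryTheory

noncomputable section

namespace Straight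

/-! ### The group `L(X, Y)` and straight invariants -/

/-- The group `L(X, Y)`: the subgroup of `Hom(⟨X⟩, ⟨Y⟩)` generated by the homomorphisms that send
every basis element `⟨x⟩` to a basis element `⟨y⟩` or to `0`. Here `⟨X⟩ = X →₀ ℤ` is the free
abelian group with basis `⟨x⟩ = Finsupp.single x 1`. -/
def LGroup (X Y : Type) : AddSubgroup ((X →₀ ℤ) →+ (Y →₀ ℤ)) :=
  AddSubgroup.closure {u | ∀ x : X,
    (∃ y : Y, u (Finsupp.single x 1) = Finsupp.single y 1) ∨ u (Finsupp.single x 1) = 0}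

/-- The element `⟨a⟩` of `L(X, Y)` induced by a map `a : X → Y`; `⟨a⟩(⟨x⟩) = ⟨a(x)⟩`. -/
def bracket {X Y : Type} (a : X → Y) : LGroup X Y :=
  ⟨Finsupp.mapDomain.addMonoidHom a, AddSubgroup.subset_closure fun x =>
    Or.inl ⟨a x, by simp [Finsupp.mapDomain.addMonoidHom]⟩⟩

/-- The set `[X, Y]` of homotopy classes of continuous maps. -/
def HtpyClasses (X Y : Type) [TopologicalSpace X] [TopologicalSpace Y] : Type :=
  Quotient (⟨ContinuousMap.Homotopic, ContinuousMap.Homotopic.equivalence⟩ : Setoid C(X, Y))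

/-- The homotopy class `[a]` of a continuous map `a`. -/
def cls {X Y : Type} [TopologicalSpace X] [TopologicalSpace Y] (a : C(X, Y)) : HtpyClasses X Y :=
  Quotient.mk _ a

/-- An invariant `f : [X, Y] → M` is straight if `f([a]) = F(⟨a⟩)` for some homomorphism
`F : L(X, Y) → M`. -/
def IsStraight {X Y : Type} [TopologicalSpace X] [TopologicalSpace Y] {M : Type} [AddCommGroup M]
    (f : HtpyClasses X Y → M) : Prop :=
  ∃ F : LGroup X Y →+ M, ∀ a : C(X, Y), f (cls a) = F (bracket a)

/-! ### Singular chains and the main invariant -/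

/-- The integral singular chain complex `SX`. -/
abbrev singChain (X : Type) [TopologicalSpace X] : ChainComplex (ModuleCat.{0} ℤ) ℕ :=
  ((AlgebraicTopology.singularChainComplexFunctor (ModuleCat.{0} ℤ)).obj (ModuleCat.of ℤ ℤ)).obj
    (TopCat.of X)

/-- The morphism `Sa : SX ⟶ SY` induced by a continuous map `a`. -/
abbrev singChainMap {X Y : Type} [TopologicalSpace X] [TopologicalSpace Y] (a : C(X, Y)) :
    singChain X ⟶ singChain Y :=
  ((AlgebraicTopology.singularChainComplexFunctor (ModuleCat.{0} ℤ)).obj (ModuleCat.of ℤ ℤ)).map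
    (TopCat.ofHom a)

/-- The abelian group `[SX, SY]` of chain homotopy classes of morphisms `SX ⟶ SY`. -/
abbrev ChainClasses (X Y : Type) [TopologicalSpace X] [TopologicalSpace Y] : Type :=
  (HomotopyCategory.quotient (ModuleCat.{0} ℤ) (ComplexShape.down ℕ)).obj (singChain X) ⟶
    (HomotopyCategory.quotient (ModuleCat.{0} ℤ) (ComplexShape.down ℕ)).obj (singChain Y)

/-- The main invariant `h : [X, Y] → [SX, SY]`, `h([a]) = [Sa]`. -/
def mainInv (X Y : Type) [TopologicalSpace X] [TopologicalSpace Y] :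
    HtpyClasses X Y → ChainClasses X Y :=
  Quotient.lift
    (fun a => (HomotopyCategory.quotient (ModuleCat.{0} ℤ) (ComplexShape.down ℕ)).map
      (singChainMap a))
    (fun a b hab => HomotopyCategory.eq_of_homotopy _ _
      (TopCat.Homotopy.singularChainComplexFunctorObjMap
        (f := TopCat.ofHom a) (g := TopCat.ofHom b) (Classical.choice hab) (ModuleCat.of ℤ ℤ)))

/-- The first singular homology group `H₁(X)`. -/
abbrev H1 (X : Type) [TopologicalSpace X] : ModuleCat.{0} ℤ := (singChain X).homology 1

/-- The homomorphism `a_* : H₁(X) → H₁(Y)` induced by a continuous map. -/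
def H1map {X Y : Type} [TopologicalSpace X] [TopologicalSpace Y] (a : C(X, Y)) : H1 X →+ H1 Y :=
  (HomologicalComplex.homologyMap (singChainMap a) 1).hom.toAddMonoidHom

/-- The homomorphism on first homology induced by a chain homotopy class of morphisms `K ⟶ L`. -/
def homologyClassMap {K L : ChainComplex (ModuleCat.{0} ℤ) ℕ}
    (v : (HomotopyCategory.quotient (ModuleCat.{0} ℤ) (ComplexShape.down ℕ)).obj K ⟶
      (HomotopyCategory.quotient (ModuleCat.{0} ℤ) (ComplexShape.down ℕ)).obj L) :
    (HomologicalComplex.homologyFunctor (ModuleCat.{0} ℤ) (ComplexShape.down ℕ) 1).obj K ⟶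
      (HomologicalComplex.homologyFunctor (ModuleCat.{0} ℤ) (ComplexShape.down ℕ) 1).obj L :=
  (HomotopyCategory.homologyFunctorFactors (ModuleCat.{0} ℤ) (ComplexShape.down ℕ) 1).inv.app K ≫
    (HomotopyCategory.homologyFunctor (ModuleCat.{0} ℤ) (ComplexShape.down ℕ) 1).map v ≫
    (HomotopyCategory.homologyFunctorFactors (ModuleCat.{0} ℤ) (ComplexShape.down ℕ) 1).hom.app L

theorem homologyClassMap_zero {K L : ChainComplex (ModuleCat.{0} ℤ) ℕ} :
    homologyClassMap (0 : (HomotopyCategory.quotient (ModuleCat.{0} ℤ) (ComplexShape.down ℕ)).obj K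
      ⟶ (HomotopyCategory.quotient (ModuleCat.{0} ℤ) (ComplexShape.down ℕ)).obj L) = 0 := by
  unfold homologyClassMap
  rw [Functor.map_zero, Limits.zero_comp, Limits.comp_zero]

theorem homologyClassMap_add {K L : ChainComplex (ModuleCat.{0} ℤ) ℕ}
    (v w : (HomotopyCategory.quotient (ModuleCat.{0} ℤ) (ComplexShape.down ℕ)).obj K ⟶
      (HomotopyCategory.quotient (ModuleCat.{0} ℤ) (ComplexShape.down ℕ)).obj L) :
    homologyClassMap (v + w) = homologyClassMap v + homologyClassMap w := by
  unfold homologyClassMap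
  rw [Functor.map_add, Preadditive.add_comp, Preadditive.comp_add]

/-- On the class of an actual morphism `φ`, this is the usual induced map on homology. -/
theorem homologyClassMap_map {K L : ChainComplex (ModuleCat.{0} ℤ) ℕ} (φ : K ⟶ L) :
    homologyClassMap
        ((HomotopyCategory.quotient (ModuleCat.{0} ℤ) (ComplexShape.down ℕ)).map φ) =
      (HomologicalComplex.homologyFunctor (ModuleCat.{0} ℤ) (ComplexShape.down ℕ) 1).map φ := by
  have h := (HomotopyCategory.homologyFunctorFactors (ModuleCat.{0} ℤ)
    (ComplexShape.down ℕ) 1).hom.naturality φ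
  dsimp only [Functor.comp_map] at h
  unfold homologyClassMap
  rw [h, Iso.inv_hom_id_app_assoc]

/-- The homomorphism `v_* : H₁(X) → H₁(Y)` induced by (the homotopy class of) a morphism
`v : SX ⟶ SY`. -/
def H1chain {X Y : Type} [TopologicalSpace X] [TopologicalSpace Y] (v : ChainClasses X Y) :
    H1 X →+ H1 Y :=
  (homologyClassMap v).hom.toAddMonoidHom

/-- The homomorphism induced by `h([a])` is `a_*`. -/
theorem H1chain_mainInv {X Y : Type} [TopologicalSpace X] [TopologicalSpace Y] (a : C(X, Y)) :
    H1chain (mainInv X Y (cls a)) = H1map a :=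
  congrArg (fun f => f.hom.toAddMonoidHom) (homologyClassMap_map (singChainMap a))

/-- For `e ∈ H₁(X)` and a homomorphism `k : H₁(Y) → ℚ`, the homomorphism
`[SX, SY] → ℚ`, `[v] ↦ k(v_*(e))`. -/
def evalHom {X Y : Type} [TopologicalSpace X] [TopologicalSpace Y] (e : H1 X) (k : H1 Y →+ ℚ) :
    ChainClasses X Y →+ ℚ where
  toFun v := k (H1chain v e)
  map_zero' := by
    have : H1chain (0 : ChainClasses X Y) = 0 :=
      congrArg (fun f => f.hom.toAddMonoidHom)
        (homologyClassMap_zero (K := singChain X) (L := singChain Y))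
    rw [this]
    simp
  map_add' v w := by
    have : H1chain (v + w) = H1chain v + H1chain w :=
      congrArg (fun f => f.hom.toAddMonoidHom) (homologyClassMap_add v w)
    rw [this]
    simp

/-- The singular `1`-simplex given by a path in `X`. -/
def pathSimplex {X : Type} [TopologicalSpace X] (γ : C(unitInterval, X)) :
    (TopCat.toSSet.obj (TopCat.of X)).obj (Opposite.op (SimplexCategory.mk 1)) :=
  TopCat.toSSetObj₁Equiv.symm
    (TopCat.ofHom (γ.comp ⟨TopCat.I.homeomorph, TopCat.I.homeomorph.continuous⟩))

theorem loop_d {X : Type} [TopologicalSpace X] (γ : C(unitInterval, X)) (hγ : γ 0 = γ 1) :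
    SSet.ιChainComplex (R := ModuleCat.of ℤ ℤ) (TopCat.toSSet.obj (TopCat.of X))
      (pathSimplex γ) ≫ (singChain X).d 1 0 = 0 := by
  have h := SSet.ιChainComplex_d (TopCat.toSSet.obj (TopCat.of X)) (R := ModuleCat.of ℤ ℤ)
    (pathSimplex γ)
  refine h.trans ?_
  rw [Fin.sum_univ_two]
  have h0 : (TopCat.toSSet.obj (TopCat.of X)).δ 0 (pathSimplex γ) =
      (TopCat.toSSet.obj (TopCat.of X)).δ 1 (pathSimplex γ) := by
    refine (TopCat.δ_zero_toSSetObj₁Equiv.symm _).trans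
      (Eq.trans ?_ (TopCat.δ_one_toSSetObj₁Equiv.symm _).symm)
    exact congrArg _ hγ.symm
  rw [h0]
  simp only [Fin.val_zero, Fin.val_one, pow_zero, pow_one, one_smul, neg_smul]
  exact add_neg_cancel _

/-- The class in `H₁(X)` of a loop `γ : [0, 1] → X`, regarded as a singular `1`-cycle. -/
def loopClass {X : Type} [TopologicalSpace X] (γ : C(unitInterval, X)) (hγ : γ 0 = γ 1) : H1 X :=
  ((singChain X).liftCycles
    (SSet.ιChainComplex (R := ModuleCat.of ℤ ℤ) (TopCat.toSSet.obj (TopCat.of X)) (pathSimplex γ))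
    0 (by simp) (loop_d γ hγ) ≫ (singChain X).homologyπ 1).hom (1 : ℤ)

/-! ### Valid and finitary spaces -/

/-- `Z` is a (Hausdorff) CW-complex. -/
def IsCW (Z : Type) [TopologicalSpace Z] : Prop :=
  T2Space Z ∧ Nonempty (Topology.CWComplex (Set.univ : Set Z))

/-- A space is valid if it is homotopy equivalent to a CW-complex. -/
def IsValid (X : Type) [TopologicalSpace X] : Prop :=
  ∃ (Z : Type) (_ : TopologicalSpace Z), IsCW Z ∧ Nonempty (ContinuousMap.HomotopyEquiv X Z)

/-- The map on path components induced by a continuous map. -/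
def pi0Map {A B : Type} [TopologicalSpace A] [TopologicalSpace B] (f : C(A, B)) :
    ZerothHomotopy A → ZerothHomotopy B :=
  Quotient.map' f fun _ _ h => h.map f.continuous

/-- The map on `n`-dimensional generalized loops induced by a continuous map. -/
def genLoopMap {A B : Type} [TopologicalSpace A] [TopologicalSpace B] (f : C(A, B)) (n : ℕ) (a : A)
    (p : GenLoop (Fin n) A a) : GenLoop (Fin n) B (f a) :=
  ⟨f.comp p.1, fun y hy => congrArg f (p.2 y hy)⟩

/-- The map on homotopy groups `π_n(A, a) → π_n(B, f(a))` induced by a continuous map. -/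
def piMap {A B : Type} [TopologicalSpace A] [TopologicalSpace B] (f : C(A, B)) (n : ℕ) (a : A) :
    HomotopyGroup (Fin n) A a → HomotopyGroup (Fin n) B (f a) :=
  Quotient.map (genLoopMap f n a)
    fun _ _ h => ContinuousMap.HomotopicRel.comp_continuousMap h f

/-- A weak homotopy equivalence: a map inducing bijections on path components and on all homotopy
groups at all base points. -/
def IsWeakEquiv {A B : Type} [TopologicalSpace A] [TopologicalSpace B] (f : C(A, B)) : Prop :=
  Function.Bijective (pi0Map f) ∧ ∀ (n : ℕ) (a : A), Function.Bijective (piMap f n a)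

/-- Two spaces are weakly homotopy equivalent if they are connected by a zigzag of weak homotopy
equivalences. -/
def WeaklyEquivalent (X Y : Type) [TopologicalSpace X] [TopologicalSpace Y] : Prop :=
  Relation.EqvGen (fun A B : TopCat.{0} => ∃ f : C(A, B), IsWeakEquiv f)
    (TopCat.of X) (TopCat.of Y)

/-- A space is finitary if it is weakly homotopy equivalent to a compact CW-complex. -/
def IsFinitary (X : Type) [TopologicalSpace X] : Prop :=
  ∃ (Z : Type) (_ : TopologicalSpace Z), IsCW Z ∧ CompactSpace Z ∧ WeaklyEquivalent X Z

/-! ### The circle, the Hawaiian ear-ring and the maps between them -/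

/-- The circle, as the one-point compactification of the open ray `(0, ∞)`. -/
abbrev RayCircle : Type := OnePoint {x : ℝ // 0 < x}

/-- The subspace `(0, ∞) ∖ ℕ` of the real line. -/
abbrev CutRay : Type := {x : ℝ // 0 < x ∧ ∀ n : ℕ, x ≠ n}

/-- The Hawaiian ear-ring, as the one-point compactification of `(0, ∞) ∖ ℕ`. -/
abbrev Earring : Type := OnePoint CutRay

theorem continuous_toOnePoint {Z V : Type} [TopologicalSpace Z] [TopologicalSpace V]
    (f : Z → OnePoint V)
    (h1 : ∀ W : Set V, IsOpen W → IsOpen (f ⁻¹' ((↑) '' W)))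
    (h2 : ∀ K : Set V, IsClosed K → IsCompact K → IsClosed (f ⁻¹' ((↑) '' K))) :
    Continuous f := by
  rw [continuous_def]
  intro s hs
  by_cases h : OnePoint.infty ∈ s
  · have hs' := (OnePoint.isOpen_iff_of_mem h).1 hs
    have := h2 _ hs'.1 hs'.2
    rw [← isClosed_compl_iff]
    convert this using 1
    ext z
    simp only [Set.mem_compl_iff, Set.mem_preimage]
    constructor
    · intro hz
      rcases OnePoint.ne_infty_iff_exists.1 (fun hh : f z = OnePoint.infty => hz (hh ▸ h))
        with ⟨v, hv⟩
      exact ⟨v, by simpa [hv] using hz, hv⟩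
    · rintro ⟨v, hv, hvz⟩ hz
      exact hv (by simpa [hvz] using hz)
  · have hs' := (OnePoint.isOpen_iff_of_notMem h).1 hs
    have := h1 _ hs'
    convert this using 1
    ext z
    simp only [Set.mem_preimage]
    constructor
    · intro hz
      rcases OnePoint.ne_infty_iff_exists.1 (fun hh : f z = OnePoint.infty => h (hh ▸ hz))
        with ⟨v, hv⟩
      exact ⟨v, by simpa [hv] using hz, hv⟩
    · rintro ⟨v, hv, hvz⟩
      simpa [hvz] using hv

open Classical in
/-- The standard loop around the circle: `t ↦ t / (1 - t)` for `0 < t < 1`, and `0, 1 ↦ ∞`. -/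
def stdLoopFun (t : unitInterval) : RayCircle :=
  if h : 0 < (t : ℝ) ∧ (t : ℝ) < 1 then
    ((⟨(t : ℝ) / (1 - t), div_pos h.1 (sub_pos.2 h.2)⟩ : {x : ℝ // 0 < x}) : RayCircle)
  else OnePoint.infty

theorem stdLoopFun_preimage (W : Set {x : ℝ // 0 < x}) :
    stdLoopFun ⁻¹' ((↑) '' W) =
      Subtype.val ⁻¹' ((fun x : {x : ℝ // 0 < x} => (x : ℝ) / (1 + x)) '' W) := by
  ext t
  simp only [Set.mem_preimage, Set.mem_image]
  constructor
  · rintro ⟨w, hw, hwt⟩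
    unfold stdLoopFun at hwt
    split_ifs at hwt with h
    · rw [OnePoint.coe_eq_coe] at hwt
      refine ⟨w, hw, ?_⟩
      have h1 : (1 - (t : ℝ)) ≠ 0 := (sub_pos.2 h.2).ne'
      rw [hwt]
      field_simp
      ring
    · exact absurd hwt (OnePoint.coe_ne_infty w)
  · rintro ⟨w, hw, hwt⟩
    have hw0 : (0 : ℝ) < w := w.2
    have h : 0 < (t : ℝ) ∧ (t : ℝ) < 1 := by
      rw [← hwt]
      refine ⟨by positivity, ?_⟩
      rw [div_lt_one (by positivity)]
      linarith
    refine ⟨w, hw, ?_⟩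
    unfold stdLoopFun
    rw [dif_pos h, OnePoint.coe_eq_coe]
    apply Subtype.ext
    simp only [← hwt]
    field_simp
    ring

theorem continuous_stdLoopFun : Continuous stdLoopFun := by
  refine continuous_toOnePoint _ (fun W hW => ?_) (fun K _ hK => ?_)
  · obtain ⟨O, hO, rfl⟩ := isOpen_induced_iff.1 hW
    rw [stdLoopFun_preimage]
    refine IsOpen.preimage continuous_subtype_val ?_
    have : (fun x : {x : ℝ // 0 < x} => (x : ℝ) / (1 + x)) '' (Subtype.val ⁻¹' O) =
        Set.Ioo 0 1 ∩ (fun t : ℝ => t / (1 - t)) ⁻¹' (O ∩ Set.Ioi 0) := by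
      ext t
      simp only [Set.mem_image, Set.mem_preimage, Set.mem_inter_iff, Set.mem_Ioo, Set.mem_Ioi]
      constructor
      · rintro ⟨w, hw, rfl⟩
        have hw0 : (0 : ℝ) < w := w.2
        have h1 : (w : ℝ) / (1 + w) / (1 - w / (1 + w)) = w := by
          field_simp
          ring
        rw [h1]
        refine ⟨⟨by positivity, ?_⟩, hw, hw0⟩
        rw [div_lt_one (by positivity)]
        linarith
      · rintro ⟨h, hO, h0⟩
        refine ⟨⟨_, h0⟩, hO, ?_⟩
        have h1 : (1 - (t : ℝ)) ≠ 0 := (sub_pos.2 h.2).ne'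
        simp only
        field_simp
        ring
    rw [this]
    refine ContinuousOn.isOpen_inter_preimage ?_ isOpen_Ioo (hO.inter isOpen_Ioi)
    exact continuousOn_id.div (continuousOn_const.sub continuousOn_id)
      (fun t ht => (sub_pos.2 ht.2).ne')
  · rw [stdLoopFun_preimage]
    refine IsClosed.preimage continuous_subtype_val (IsCompact.isClosed (hK.image ?_))
    exact continuous_subtype_val.div (continuous_const.add continuous_subtype_val)
      (fun x => by have := x.2; positivity)

/-- The standard loop around the circle, as a continuous map. -/
def stdLoop : C(unitInterval, RayCircle) := ⟨stdLoopFun, continuous_stdLoopFun⟩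

theorem stdLoop_closed : stdLoop 0 = stdLoop 1 := by
  simp [stdLoop, stdLoopFun]

/-- The standard generator `e` of `H₁` of the circle. -/
def fundClass : H1 RayCircle := loopClass stdLoop stdLoop_closed

/-- The real number `⌊(x + 1) / 2⌋ + (-1) ^ ⌊x / 2⌋ {-x}`. -/
def mReal (x : ℝ) : ℝ :=
  (⌊(x + 1) / 2⌋ : ℝ) + (-1 : ℝ) ^ (⌊x / 2⌋ : ℤ) * Int.fract (-x)

theorem mReal_eq (x : ℝ) : ∃ z : ℤ, mReal x = z - x ∨ mReal x = z + x := by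
  unfold mReal
  have h : Int.fract (-x) = -x - ⌊-x⌋ := rfl
  rcases Int.even_or_odd ⌊x / 2⌋ with he | ho
  · refine ⟨⌊(x + 1) / 2⌋ - ⌊-x⌋, Or.inl ?_⟩
    rw [he.neg_one_zpow, h]
    push_cast
    ring
  · refine ⟨⌊(x + 1) / 2⌋ + ⌊-x⌋, Or.inr ?_⟩
    rw [ho.neg_one_zpow, h]
    push_cast
    ring

theorem mReal_int {x : ℝ} {n : ℤ} (h : mReal x = n) : ∃ k : ℤ, x = k := by
  obtain ⟨z, hz | hz⟩ := mReal_eq x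
  · exact ⟨z - n, by push_cast; linarith⟩
  · exact ⟨n - z, by push_cast; linarith⟩

theorem mReal_lower (x : ℝ) : x / 2 - 3 / 2 < mReal x := by
  unfold mReal
  have h1 := Int.lt_floor_add_one ((x + 1) / 2)
  have h2 := Int.fract_nonneg (-x)
  have h3 := Int.fract_lt_one (-x)
  rcases Int.even_or_odd ⌊x / 2⌋ with he | ho
  · rw [he.neg_one_zpow]
    linarith
  · rw [ho.neg_one_zpow]
    linarith

theorem mReal_pos {x : ℝ} (hx : 0 < x) (hn : ∀ n : ℕ, x ≠ n) : 0 < mReal x := by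
  unfold mReal
  have h2 := Int.fract_nonneg (-x)
  have h3 := Int.fract_lt_one (-x)
  have h4 : Int.fract (-x) ≠ 0 := by
    intro h
    obtain ⟨z, hz⟩ := Int.fract_eq_zero_iff.1 h
    have hz0 : (0 : ℤ) ≤ -z := by
      have : ((0 : ℤ) : ℝ) ≤ ((-z : ℤ) : ℝ) := by push_cast; linarith
      exact_mod_cast this
    obtain ⟨n, hn'⟩ := Int.eq_ofNat_of_zero_le hz0
    refine hn n ?_
    have : ((-z : ℤ) : ℝ) = ((n : ℤ) : ℝ) := by rw [hn']
    push_cast at this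
    linarith
  have h5 : 0 < Int.fract (-x) := lt_of_le_of_ne h2 (Ne.symm h4)
  have h0 : (0 : ℤ) ≤ ⌊(x + 1) / 2⌋ := Int.floor_nonneg.2 (by linarith)
  rcases Int.even_or_odd ⌊x / 2⌋ with he | ho
  · rw [he.neg_one_zpow]
    have : (0 : ℝ) ≤ (⌊(x + 1) / 2⌋ : ℝ) := by exact_mod_cast h0
    linarith
  · rw [ho.neg_one_zpow]
    have h6 : (0 : ℤ) ≤ ⌊x / 2⌋ := Int.floor_nonneg.2 (by linarith)
    have h7 : (1 : ℤ) ≤ ⌊x / 2⌋ := by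
      rcases ho with ⟨c, hc⟩
      omega
    have h8 : ⌊x / 2⌋ ≤ ⌊(x + 1) / 2⌋ := Int.floor_mono (by linarith)
    have : (1 : ℝ) ≤ (⌊(x + 1) / 2⌋ : ℝ) := by exact_mod_cast h7.trans h8
    linarith

theorem mReal_mem {x : ℝ} (hx : 0 < x) (hn : ∀ n : ℕ, x ≠ n) :
    0 < mReal x ∧ ∀ n : ℕ, mReal x ≠ n := by
  refine ⟨mReal_pos hx hn, fun n h => ?_⟩
  obtain ⟨k, hk⟩ := mReal_int (n := n) (by exact_mod_cast h)
  have hk0 : (0 : ℤ) ≤ k := by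
    have : ((0 : ℤ) : ℝ) ≤ (k : ℝ) := by push_cast; linarith
    exact_mod_cast this
  obtain ⟨j, rfl⟩ := Int.eq_ofNat_of_zero_le hk0
  exact hn j (by simpa using hk)

open Classical in
/-- The map `m` from the circle to the Hawaiian ear-ring, given by `mReal` on `(0, ∞) ∖ ℕ` and
sending all other points to `∞`. -/
def mFun : RayCircle → Earring
  | none => OnePoint.infty
  | some x =>
    if h : ∀ n : ℕ, (x : ℝ) ≠ n then
      ((⟨mReal x, mReal_mem x.2 h⟩ : CutRay) : Earring)
    else OnePoint.infty

theorem isOpen_nonnat : IsOpen {x : ℝ | ∀ n : ℕ, x ≠ n} := by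
  have : {x : ℝ | ∀ n : ℕ, x ≠ n} = (Set.range ((↑) : ℕ → ℝ))ᶜ := by
    ext x
    simp [eq_comm]
  rw [this, isOpen_compl_iff]
  exact Nat.isClosedEmbedding_coe_real.isClosed_range

theorem continuousAt_floor_real {x : ℝ} (hx : ∀ k : ℤ, x ≠ k) :
    ∀ᶠ y in nhds x, ⌊y⌋ = ⌊x⌋ := by
  have h1 : (⌊x⌋ : ℝ) < x := lt_of_le_of_ne (Int.floor_le x) (hx _).symm
  filter_upwards [Ioo_mem_nhds h1 (Int.lt_floor_add_one x)] with y hy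
  exact Int.floor_eq_iff.2 ⟨hy.1.le, hy.2⟩

theorem mReal_continuousAt {x : ℝ} (hx : ∀ k : ℤ, x ≠ k) : ContinuousAt mReal x := by
  have e1 : ∀ᶠ y in nhds x, ⌊(y + 1) / 2⌋ = ⌊(x + 1) / 2⌋ := by
    have hc : ContinuousAt (fun y : ℝ => (y + 1) / 2) x := by fun_prop
    refine hc.eventually (continuousAt_floor_real (x := (x + 1) / 2) fun k hk => ?_)
    exact hx (2 * k - 1) (by push_cast; linarith)
  have e2 : ∀ᶠ y in nhds x, ⌊y / 2⌋ = ⌊x / 2⌋ := by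
    have hc : ContinuousAt (fun y : ℝ => y / 2) x := by fun_prop
    refine hc.eventually (continuousAt_floor_real (x := x / 2) fun k hk => ?_)
    exact hx (2 * k) (by push_cast; linarith)
  have e3 : ∀ᶠ y in nhds x, ⌊-y⌋ = ⌊-x⌋ := by
    have hc : ContinuousAt (fun y : ℝ => -y) x := by fun_prop
    refine hc.eventually (continuousAt_floor_real (x := -x) fun k hk => ?_)
    exact hx (-k) (by push_cast; linarith)
  have : (fun y : ℝ => (⌊(x + 1) / 2⌋ : ℝ) + (-1 : ℝ) ^ (⌊x / 2⌋ : ℤ) * (-y - ⌊-x⌋)) =ᶠ[nhds x]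
      mReal := by
    filter_upwards [e1, e2, e3] with y h1 h2 h3
    unfold mReal
    rw [h1, h2, Int.fract, h3]
  refine ContinuousAt.congr ?_ this
  fun_prop

theorem not_int_of {x : ℝ} (hx : 0 < x) (hn : ∀ n : ℕ, x ≠ n) (k : ℤ) : x ≠ k := by
  intro hk
  have hk0 : (0 : ℤ) ≤ k := by
    have : ((0 : ℤ) : ℝ) ≤ (k : ℝ) := by push_cast; linarith
    exact_mod_cast this
  obtain ⟨j, rfl⟩ := Int.eq_ofNat_of_zero_le hk0
  exact hn j (by simpa using hk)

theorem mReal_continuousOn : ContinuousOn mReal {x : ℝ | 0 < x ∧ ∀ n : ℕ, x ≠ n} :=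
  fun _ hx => (mReal_continuousAt (not_int_of hx.1 hx.2)).continuousWithinAt

theorem isOpen_cutRay : IsOpen {x : ℝ | 0 < x ∧ ∀ n : ℕ, x ≠ n} :=
  isOpen_Ioi.inter isOpen_nonnat

open Classical in
theorem mFun_preimage (W : Set CutRay) :
    mFun ⁻¹' ((↑) '' W) = (↑) '' (Subtype.val ⁻¹'
      ({x : ℝ | 0 < x ∧ ∀ n : ℕ, x ≠ n} ∩ mReal ⁻¹' (Subtype.val '' W)) : Set {x : ℝ // 0 < x}) := by
  ext z
  induction z using OnePoint.rec with
  | infty =>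
    simp only [Set.mem_preimage, Set.mem_image]
    constructor
    · rintro ⟨w, _, hw⟩
      exact absurd hw (OnePoint.coe_ne_infty w)
    · rintro ⟨w, _, hw⟩
      exact absurd hw (OnePoint.coe_ne_infty w)
  | coe x =>
    rw [OnePoint.coe_injective.mem_set_image]
    have hdef : mFun (x : RayCircle) = if h : ∀ n : ℕ, (x : ℝ) ≠ n then
      ((⟨mReal x, mReal_mem x.2 h⟩ : CutRay) : Earring) else OnePoint.infty := rfl
    rw [Set.mem_preimage, hdef]
    by_cases h : ∀ n : ℕ, (x : ℝ) ≠ n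
    · rw [dif_pos h, OnePoint.coe_injective.mem_set_image]
      simp only [Set.mem_preimage, Set.mem_inter_iff, Set.mem_ofPred_eq]
      constructor
      · intro hW
        exact ⟨⟨x.2, h⟩, _, hW, rfl⟩
      · rintro ⟨_, w, hw, hwx⟩
        have : w = ⟨mReal x, mReal_mem x.2 h⟩ := Subtype.ext hwx
        rwa [← this]
    · rw [dif_neg h]
      simp only [Set.mem_preimage, Set.mem_inter_iff, Set.mem_ofPred_eq]
      constructor
      · rintro ⟨w, _, hw⟩
        exact absurd hw (OnePoint.coe_ne_infty w)
      · rintro ⟨⟨_, hh⟩, _⟩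
        exact absurd hh h

theorem mReal_dist {x : ℝ} (k : ℤ) : |mReal x - round (mReal x)| ≤ |x - k| := by
  obtain ⟨z, hz | hz⟩ := mReal_eq x
  · refine (round_le (mReal x) (z - k)).trans ?_
    rw [hz]
    push_cast
    rw [abs_sub_comm x k]
    apply le_of_eq
    congr 1
    ring
  · refine (round_le (mReal x) (z + k)).trans ?_
    rw [hz]
    push_cast
    apply le_of_eq
    congr 1
    ring

theorem continuous_mFun : Continuous mFun := by
  refine continuous_toOnePoint _ (fun W hW => ?_) (fun K _ hK => ?_)
  · rw [mFun_preimage, OnePoint.isOpen_image_coe]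
    refine IsOpen.preimage continuous_subtype_val ?_
    exact mReal_continuousOn.isOpen_inter_preimage isOpen_cutRay
      (isOpen_cutRay.isOpenMap_subtype_val W hW)
  · rw [mFun_preimage, OnePoint.isClosed_image_coe]
    set KR : Set ℝ := Subtype.val '' K with hKR
    have hKc : IsCompact KR := hK.image continuous_subtype_val
    have hKsub : ∀ y ∈ KR, 0 < y ∧ ∀ n : ℕ, y ≠ n := by
      rintro _ ⟨w, _, rfl⟩
      exact w.2
    suffices hP : IsCompact ({x : ℝ | 0 < x ∧ ∀ n : ℕ, x ≠ n} ∩ mReal ⁻¹' KR) by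
      refine ⟨hP.isClosed.preimage continuous_subtype_val, ?_⟩
      rw [Subtype.isCompact_iff]
      convert hP using 1
      exact (Subtype.image_preimage_coe _ _).trans (Set.inter_eq_right.2 (fun x hx => hx.1.1))
    obtain ⟨B, hB⟩ := hKc.bddAbove
    have hcl : IsClosed (Set.range ((↑) : ℤ → ℝ)) :=
      Int.isClosedEmbedding_coe_real.isClosed_range
    have hdisj : Disjoint KR (Set.range ((↑) : ℤ → ℝ)) := by
      rw [Set.disjoint_left]
      rintro y hy ⟨k, hk⟩
      exact not_int_of (hKsub y hy).1 (hKsub y hy).2 k hk.symm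
    obtain ⟨δ, hδ, hδK⟩ := hdisj.exists_thickenings hKc hcl
    have hδK' : ∀ y ∈ KR, ∀ k : ℤ, δ ≤ |y - k| := by
      intro y hy k
      by_contra hlt
      refine Set.disjoint_left.1 hδK (Metric.self_subset_thickening hδ _ hy) ?_
      rw [Metric.mem_thickening_iff]
      exact ⟨k, ⟨k, rfl⟩, by rw [Real.dist_eq]; exact not_le.1 hlt⟩
    have hD : IsClosed (Set.Icc 0 (2 * B + 3) ∩ ⋂ k : ℤ, {x : ℝ | δ ≤ |x - k|}) :=
      isClosed_Icc.inter (isClosed_iInter fun k =>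
        isClosed_le continuous_const (by fun_prop))
    have hDsub : Set.Icc 0 (2 * B + 3) ∩ ⋂ k : ℤ, {x : ℝ | δ ≤ |x - k|} ⊆
        {x : ℝ | 0 < x ∧ ∀ n : ℕ, x ≠ n} := by
      rintro x ⟨⟨hx0, _⟩, hx⟩
      have hne : ∀ k : ℤ, x ≠ k := by
        intro k hk
        have h1 : δ ≤ |x - k| := Set.mem_iInter.1 hx k
        rw [hk] at h1
        simp at h1
        linarith
      refine ⟨lt_of_le_of_ne hx0 ?_, fun n => ?_⟩
      · exact fun h => hne 0 (by simpa using h.symm)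
      · exact fun h => hne n (by simpa using h)
    have heq : {x : ℝ | 0 < x ∧ ∀ n : ℕ, x ≠ n} ∩ mReal ⁻¹' KR =
        (Set.Icc 0 (2 * B + 3) ∩ ⋂ k : ℤ, {x : ℝ | δ ≤ |x - k|}) ∩ mReal ⁻¹' KR := by
      ext x
      constructor
      · rintro ⟨hx, hxK⟩
        refine ⟨⟨⟨hx.1.le, ?_⟩, ?_⟩, hxK⟩
        · have h1 := mReal_lower x
          have h2 := hB hxK
          linarith
        · refine Set.mem_iInter.2 fun k => ?_
          exact (hδK' _ hxK _).trans (mReal_dist k)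
      · rintro ⟨hx, hxK⟩
        exact ⟨hDsub hx, hxK⟩
    rw [heq]
    refine IsCompact.of_isClosed_subset (isCompact_Icc (a := (0 : ℝ)) (b := 2 * B + 3)) ?_
      (fun x hx => hx.1.1)
    exact (mReal_continuousOn.mono hDsub).preimage_isClosed_of_isClosed hD hKc.isClosed

/-- The map `m ∈ C(X, Y)`. -/
def mMap : C(RayCircle, Earring) := ⟨mFun, continuous_mFun⟩

/-- `y ↦ y_(i)`: the point `∞` if `i = 1`, and `y` if `i = 0`. -/
def dropIf (i : Fin 2) (y : Earring) : Earring :=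
  if i = 1 then OnePoint.infty else y

/-- The map `r_ij`: it sends `y ∈ (0, ∞) ∖ ℕ` to `y_(j)` if `⌊y⌋` is odd and to `y_(i)` otherwise,
and fixes `∞`. -/
def rFun (i j : Fin 2) : Earring → Earring
  | none => OnePoint.infty
  | some y => if Odd ⌊(y : ℝ)⌋ then dropIf j (y : Earring) else dropIf i (y : Earring)

theorem rFun_coe (i j : Fin 2) (y : CutRay) : rFun i j (y : Earring) =
    if Odd ⌊(y : ℝ)⌋ then dropIf j (y : Earring) else dropIf i (y : Earring) := rfl

theorem rFun_cases (i j : Fin 2) (y : CutRay) :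
    rFun i j (y : Earring) = y ∨ rFun i j (y : Earring) = OnePoint.infty := by
  rw [rFun_coe]
  unfold dropIf
  split_ifs <;> simp

theorem rFun_eventually (i j : Fin 2) (y : CutRay) :
    (∀ᶠ z : CutRay in nhds y, rFun i j (z : Earring) = z) ∨
      (∀ᶠ z : CutRay in nhds y, rFun i j (z : Earring) = OnePoint.infty) := by
  have h : ∀ᶠ z : CutRay in nhds y, ⌊(z : ℝ)⌋ = ⌊(y : ℝ)⌋ :=
    continuous_subtype_val.continuousAt.eventually
      (continuousAt_floor_real (not_int_of y.2.1 y.2.2))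
  by_cases hy : rFun i j (y : Earring) = y
  · left
    filter_upwards [h] with z hz
    rw [rFun_coe] at hy ⊢
    rw [hz]
    unfold dropIf at hy ⊢
    split_ifs at hy ⊢ <;> simp_all
  · right
    filter_upwards [h] with z hz
    rw [rFun_coe] at hy ⊢
    rw [hz]
    unfold dropIf at hy ⊢
    split_ifs at hy ⊢ <;> simp_all

theorem continuous_rFun (i j : Fin 2) : Continuous (rFun i j) := by
  rw [OnePoint.continuous_iff]
  constructor
  · have h1 : Filter.Tendsto ((↑) : CutRay → Earring) (Filter.coclosedCompact CutRay)
        (nhds OnePoint.infty) := OnePoint.tendsto_coe_infty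
    rw [Filter.tendsto_def] at h1 ⊢
    intro s hs
    filter_upwards [h1 s hs] with y hy
    rcases rFun_cases i j y with h | h
    · simpa [h] using hy
    · have : (OnePoint.infty : Earring) ∈ s := mem_of_mem_nhds hs
      simpa [h] using this
  · rw [continuous_iff_continuousAt]
    intro y
    rcases rFun_eventually i j y with h | h
    · exact (OnePoint.continuous_coe.continuousAt (x := y)).congr
        (by filter_upwards [h] with z hz using hz.symm)
    · exact (continuousAt_const (y := (OnePoint.infty : Earring))).congr
        (by filter_upwards [h] with z hz using hz.symm)

/-- The map `r_ij ∈ C(Y, Y)`. -/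
def rMap (i j : Fin 2) : C(Earring, Earring) := ⟨rFun i j, continuous_rFun i j⟩

/-- The map `a_ij = r_ij ∘ m ∈ C(X, Y)`. -/
def aMap (i j : Fin 2) : C(RayCircle, Earring) := (rMap i j).comp mMap

/-- The alternating sum `⋁ z_ij = z₀₀ - z₁₀ - z₀₁ + z₁₁`. -/
def vee {M : Type} [AddCommGroup M] (z : Fin 2 → Fin 2 → M) : M :=
  z 0 0 - z 1 0 - z 0 1 + z 1 1

end Straight

end

open CategoryTheory

noncomputable section

namespace Straight

/-! The loop `m` runs through an infinite product of commutators: in the `j`-th period of length 4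
it traverses circle `2j` backwards, `2j+1` backwards, `2j` forwards, `2j+1` forwards. If all even
circles or all odd circles are collapsed, every block becomes a path followed by its reverse, so
`a_10`, `a_01`, `a_11` are nullhomotopic (`aMap_homotopic_const`), while `a_00 = m`. Pointwise, each
value `m(x)` feels at most one of the indices `i`, `j`, so the alternating sum of the `⟨a_ij⟩`
vanishes (`vee_bracket`). A straight invariant would therefore have alternating sum 0, whereas `d ∘
h` gives `k(m_*(e)) = 1`.

What remains is that `m_*(e)` is not torsion, although every finite product of commutators dies in
homology. The detecting invariant is an infinite matrix of areas. For circle-valued coordinates `a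
k` (even circles) and `b l` (odd circles), lifted to the line along a simplex, the entry `(k, l)` is
the iterated integral of `a k` against `d(b l)`. It makes sense for merely continuous maps because
the two coordinates are never nonzero together. Changing the lifts alters the matrix by one of rank
at most one (`LiftData.increment_unique`), so its class modulo finite-rank matrices is an additive
singular cocycle (`areaCocycle`). For `m` each commutator contributes area 1 to its own diagonal
entry, so the matrix is the identity, which has infinite rank (`areaHom_m_ne_zero`). The quotient is
a real vector space; hence `m_*(e)` has infinite order and a rational functional takes the value 1
on it. -/

section SingularChains

/-! ### Singular 1-cocycles, functoriality of `H₁`, and lifting to the line -/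

open Simplicial

/-- The `i`-th face inclusion of the standard topological simplex. -/
def simplexFace (n : ℕ) (i : Fin (n + 2)) :
    C(stdSimplex ℝ (Fin (n + 1)), stdSimplex ℝ (Fin (n + 2))) :=
  ⟨stdSimplex.map i.succAbove, stdSimplex.continuous_map _⟩

/-- A singular `1`-cocycle with values in `A`, as a function on singular `1`-simplices. -/
structure Cocycle (Y : Type) [TopologicalSpace Y] (A : Type) [AddCommGroup A] where
  val : C(stdSimplex ℝ (Fin 2), Y) → A
  cond : ∀ s : C(stdSimplex ℝ (Fin 3), Y), val (s.comp (simplexFace 1 0)) -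
    val (s.comp (simplexFace 1 1)) + val (s.comp (simplexFace 1 2)) = 0

variable {Y : Type} [TopologicalSpace Y] {A : Type} [AddCommGroup A]

theorem toSSetObjEquiv_δ (s : (TopCat.toSSet.obj (TopCat.of Y)) _⦋2⦌) (i : Fin 3) :
    TopCat.toSSetObjEquiv (TopCat.of Y) _ ((TopCat.toSSet.obj (TopCat.of Y)).δ i s) =
      (TopCat.toSSetObjEquiv (TopCat.of Y) _ s).comp (simplexFace 1 i) := by
  ext z
  exact TopCat.toSSetObjEquiv_δ_apply s i z

section

variable {K L : ChainComplex (ModuleCat.{0} ℤ) ℕ} {R B : ModuleCat.{0} ℤ}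

theorem liftCycles_homology_desc (k : R ⟶ K.X 1) (hk : k ≫ K.d 1 0 = 0) (f : K.X 1 ⟶ B)
    (hf : K.d 2 1 ≫ f = 0) :
    (K.liftCycles k 0 (by simp) hk ≫ K.homologyπ 1) ≫
      (K.homologyι 1 ≫ K.descOpcycles f 2 (by simp) hf) = k ≫ f := by
  rw [Category.assoc, HomologicalComplex.homology_π_ι_assoc,
    HomologicalComplex.p_descOpcycles, HomologicalComplex.liftCycles_i_assoc]

theorem liftCycles_homologyMap (φ : K ⟶ L) (k : R ⟶ K.X 1) (hk : k ≫ K.d 1 0 = 0)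
    (l : R ⟶ L.X 1) (hl : l ≫ L.d 1 0 = 0) (h : k ≫ φ.f 1 = l) :
    (K.liftCycles k 0 (by simp) hk ≫ K.homologyπ 1) ≫ HomologicalComplex.homologyMap φ 1 =
      L.liftCycles l 0 (by simp) hl ≫ L.homologyπ 1 := by
  rw [Category.assoc, HomologicalComplex.homologyπ_naturality, ← Category.assoc]
  congr 1
  rw [← cancel_mono (L.iCycles 1), HomologicalComplex.liftCycles_i, Category.assoc,
    HomologicalComplex.cyclesMap_i, HomologicalComplex.liftCycles_i_assoc, h]

end

/-- The generator of the singular `n`-chains given by a singular simplex. -/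
def simplexChain {n : ℕ} (s : (TopCat.toSSet.obj (TopCat.of Y)) _⦋n⦌) :
    ModuleCat.of ℤ ℤ ⟶ (singChain Y).X n :=
  SSet.ιChainComplex (R := ModuleCat.of ℤ ℤ) (TopCat.toSSet.obj (TopCat.of Y)) s

theorem simplexChain_d (s : (TopCat.toSSet.obj (TopCat.of Y)) _⦋2⦌) :
    simplexChain s ≫ (singChain Y).d 2 1 =
      simplexChain ((TopCat.toSSet.obj (TopCat.of Y)).δ 0 s) -
      simplexChain ((TopCat.toSSet.obj (TopCat.of Y)).δ 1 s) +
      simplexChain ((TopCat.toSSet.obj (TopCat.of Y)).δ 2 s) := by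
  refine (SSet.ιChainComplex_d (TopCat.toSSet.obj (TopCat.of Y))
    (R := ModuleCat.of ℤ ℤ) s).trans ?_
  rw [Fin.sum_univ_three]
  simp only [Fin.val_zero, Fin.val_one, Fin.val_two, pow_zero, pow_one, one_smul, neg_smul,
    even_two, Even.neg_pow, one_pow, sub_eq_add_neg]
  rfl

/-- The homomorphism on singular `1`-chains given by a cocycle. -/
def Cocycle.chainHom (I : Cocycle Y A) : (singChain Y).X 1 ⟶ ModuleCat.of ℤ A :=
  Limits.Sigma.desc fun s => ModuleCat.ofHom
    (LinearMap.toSpanSingleton ℤ A (I.val (TopCat.toSSetObjEquiv (TopCat.of Y) _ s)))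

theorem Cocycle.simplexChain_chainHom (I : Cocycle Y A)
    (s : (TopCat.toSSet.obj (TopCat.of Y)) _⦋1⦌) :
    simplexChain s ≫ I.chainHom = ModuleCat.ofHom
        (LinearMap.toSpanSingleton ℤ A (I.val (TopCat.toSSetObjEquiv (TopCat.of Y) _ s))) :=
  Limits.Sigma.ι_desc _ _

theorem Cocycle.d_chainHom (I : Cocycle Y A) : (singChain Y).d 2 1 ≫ I.chainHom = 0 := by
  refine SSet.chainComplex_hom_ext (X := TopCat.toSSet.obj (TopCat.of Y)) fun s => ?_
  change simplexChain s ≫ (singChain Y).d 2 1 ≫ I.chainHom = simplexChain s ≫ 0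
  rw [Limits.comp_zero, ← Category.assoc, simplexChain_d, Preadditive.add_comp,
    Preadditive.sub_comp]
  simp only [I.simplexChain_chainHom]
  have e := fun i => congrArg I.val (toSSetObjEquiv_δ s i)
  have h := ((congrArg₂ (· + ·) (congrArg₂ (· - ·) (e 0) (e 1)) (e 2))).trans
    (I.cond (TopCat.toSSetObjEquiv (TopCat.of Y) _ s))
  ext
  simpa using h

/-- The homomorphism on first homology given by a cocycle. -/
def Cocycle.homologyHom (I : Cocycle Y A) : H1 Y →+ A :=
  ((singChain Y).homologyι 1 ≫ (singChain Y).descOpcycles I.chainHom 2 (by simp)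
    I.d_chainHom).hom.toAddMonoidHom

theorem Cocycle.homologyHom_loopClass (I : Cocycle Y A) (γ : C(unitInterval, Y))
    (hγ : γ 0 = γ 1) : I.homologyHom (loopClass γ hγ) =
      I.val (γ.comp ⟨stdSimplexHomeomorphUnitInterval,
        stdSimplexHomeomorphUnitInterval.continuous⟩) := by
  have h1 := (liftCycles_homology_desc (simplexChain (pathSimplex γ)) (loop_d γ hγ) I.chainHom
    I.d_chainHom).trans (I.simplexChain_chainHom _)
  have h2 := congrArg (fun f => f.hom (1 : ℤ)) h1
  refine h2.trans ?_
  refine (one_smul ℤ _).trans ?_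
  congr 1

/-- The class of a loop maps to the class of its image. -/
theorem H1map_loopClass {X : Type} [TopologicalSpace X] (a : C(X, Y)) (γ : C(unitInterval, X))
    (hγ : γ 0 = γ 1) : H1map a (loopClass γ hγ) =
      loopClass (a.comp γ) (congrArg a hγ) := by
  have h1 := liftCycles_homologyMap (singChainMap a) (simplexChain (pathSimplex γ)) (loop_d γ hγ)
    (simplexChain (pathSimplex (a.comp γ))) (loop_d (a.comp γ) (congrArg a hγ))
    (SSet.ι_chainComplexMap_f _ _ (TopCat.toSSet.map (TopCat.ofHom a)) (ModuleCat.of ℤ ℤ) _)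
  exact congrArg (fun f => f.hom (1 : ℤ)) h1

theorem H1map_homotopic {X : Type} [TopologicalSpace X] {a b : C(X, Y)} (h : a.Homotopic b) :
    H1map a = H1map b := by
  rw [← H1chain_mainInv, ← H1chain_mainInv]
  congr 2
  exact Quotient.sound h

/-- A constant map factors through a one-point space, whose first homology vanishes. -/
theorem H1map_const {X : Type} [TopologicalSpace X] (y : Y) :
    H1map (ContinuousMap.const X y) = 0 := by
  have h0 : Limits.IsZero (H1 Unit) :=
    AlgebraicTopology.isZero_singularHomologyFunctor_of_totallyDisconnectedSpace
      (ModuleCat.{0} ℤ) 1 (ModuleCat.of ℤ ℤ) (TopCat.of Unit) one_ne_zero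
  have h1 : singChainMap (ContinuousMap.const X y) =
      singChainMap (ContinuousMap.const X ()) ≫ singChainMap (ContinuousMap.const Unit y) := by
    rw [← Functor.map_comp]
    rfl
  have h2 : HomologicalComplex.homologyMap (singChainMap (ContinuousMap.const X y)) 1 = 0 := by
    rw [h1, HomologicalComplex.homologyMap_comp, h0.eq_zero_of_tgt
      (HomologicalComplex.homologyMap (singChainMap (ContinuousMap.const X ())) 1),
      Limits.zero_comp]
  exact congrArg (fun f => f.hom.toAddMonoidHom) h2

/-- Maps from contractible spaces to the circle lift to the line. -/
theorem exists_real_lift {K : Type} [TopologicalSpace K] [ContractibleSpace K]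
    (g : C(K, UnitAddCircle)) : ∃ G : C(K, ℝ), ∀ x, (G x : UnitAddCircle) = g x := by
  obtain ⟨x₀, ⟨H⟩⟩ := id_nullhomotopic K
  obtain ⟨r, hr⟩ := QuotientAddGroup.mk_surjective (g x₀)
  have cov : IsCoveringMap ((↑) : ℝ → UnitAddCircle) := AddCircle.isCoveringMap_coe 1
  -- The reversed contraction starts at a constant map, which lifts to the constant `r`; homotopy
  -- lifting carries this to a lift of `g` at time 1.
  let H' : C(unitInterval × K, UnitAddCircle) := g.comp H.symm.toContinuousMap
  have h0 : ∀ a, H' (0, a) = ((ContinuousMap.const K r a : ℝ) : UnitAddCircle) := by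
    intro a
    simpa [H'] using hr.symm
  refine ⟨(cov.liftHomotopy H' _ h0).comp ((ContinuousMap.const K 1).prodMk (.id K)), fun x => ?_⟩
  have := congrFun (cov.liftHomotopy_lifts H' _ h0) (1, x)
  simpa [H'] using this

/-- A continuous real function with integral values on a preconnected space is constant. -/
theorem eq_of_forall_int {K : Type} [TopologicalSpace K] [PreconnectedSpace K] (G : C(K, ℝ))
    (h : ∀ x, (G x : UnitAddCircle) = 0) (x y : K) : G x = G y := by
  have h' : ∀ x, ∃ n : ℤ, (n : ℝ) = G x := fun x => by
    simpa using (AddCircle.coe_eq_zero_iff (1 : ℝ)).1 (h x)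
  choose n hn using h'
  have hc : Continuous n := by
    rw [Int.isClosedEmbedding_coe_real.isEmbedding.continuous_iff]
    exact G.continuous.congr fun x => (hn x).symm
  rw [← hn x, ← hn y, PreconnectedSpace.constant inferInstance hc]

instance {n : ℕ} : ContractibleSpace (stdSimplex ℝ (Fin (n + 1))) :=
  (convex_stdSimplex ℝ _).contractibleSpace ⟨_, (stdSimplex.vertex (S := ℝ) (0 : Fin (n + 1))).2⟩

end SingularChains

/-! ### Matrices of finite rank -/

/-- Infinite real matrices of finite rank, as sums of matrices `u k * v l`. -/
def finiteRank : Submodule ℝ (ℕ → ℕ → ℝ) :=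
  Submodule.span ℝ {M | ∃ u v : ℕ → ℝ, M = fun k l => u k * v l}

/-- The rows of `u k * v l` are multiples of `v`, and the row space of a sum lies in the sum of the
row spaces. -/
theorem finiteDimensional_rows {M : ℕ → ℕ → ℝ} (hM : M ∈ finiteRank) :
    FiniteDimensional ℝ (Submodule.span ℝ (Set.range M)) := by
  refine Submodule.span_induction (p := fun M _ =>
    FiniteDimensional ℝ (Submodule.span ℝ (Set.range M))) ?_ ?_ ?_ ?_ hM
  · rintro _ ⟨u, v, rfl⟩
    have : FiniteDimensional ℝ (Submodule.span ℝ {v}) := inferInstance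
    refine Submodule.finiteDimensional_of_le (Submodule.span_le.2 ?_ :
      _ ≤ Submodule.span ℝ {v})
    rintro _ ⟨k, rfl⟩
    exact Submodule.mem_span_singleton.2 ⟨u k, rfl⟩
  · refine Submodule.finiteDimensional_of_le (Submodule.span_le.2 ?_ :
      _ ≤ (⊥ : Submodule ℝ (ℕ → ℝ)))
    rintro _ ⟨k, rfl⟩
    rfl
  · intro M N _ _ h1 h2
    refine Submodule.finiteDimensional_of_le (Submodule.span_le.2 ?_ :
      _ ≤ Submodule.span ℝ (Set.range M) ⊔ Submodule.span ℝ (Set.range N))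
    rintro _ ⟨k, rfl⟩
    exact Submodule.add_mem_sup (Submodule.subset_span ⟨k, rfl⟩) (Submodule.subset_span ⟨k, rfl⟩)
  · intro c M _ h
    refine Submodule.finiteDimensional_of_le (Submodule.span_le.2 ?_ :
      _ ≤ Submodule.span ℝ (Set.range M))
    rintro _ ⟨k, rfl⟩
    exact Submodule.smul_mem _ _ (Submodule.subset_span ⟨k, rfl⟩)

/-- The identity matrix has infinite rank. -/
theorem identity_notMem_finiteRank : (fun k l => if k = l then 1 else 0) ∉ finiteRank := by
  intro h
  have hfd := finiteDimensional_rows h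
  -- The rows of the identity are the unit vectors: infinitely many independent elements of a row
  -- space that would be finite-dimensional.
  have hli : LinearIndependent ℝ (fun k l : ℕ => if k = l then (1 : ℝ) else 0) := by
    have := Pi.linearIndependent_single_one ℕ ℝ
    convert this using 3 with k l
    simp [Pi.single_apply, eq_comm]
  have hli' := linearIndependent_span hli
  exact not_finite_iff_infinite.2 (inferInstanceAs (Infinite ℕ)) (hli'.finite)

/-! ### The area cocycle of two families of circle-valued maps -/

section LiftData

variable {Y : Type} [TopologicalSpace Y] {K K' : Type} [TopologicalSpace K] [TopologicalSpace K']
  {a b : ℕ → C(Y, UnitAddCircle)}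

/-- Lifts along `s` of the circle-valued maps `a k` and `b l`, and a real function `area k l`
that plays the role of the iterated integral `∫ (a k) d(b l)`. -/
structure LiftData (a b : ℕ → C(Y, UnitAddCircle)) (s : C(K, Y)) where
  left : ℕ → C(K, ℝ)
  right : ℕ → C(K, ℝ)
  area : ℕ → ℕ → C(K, ℝ)
  left_coe : ∀ k x, (left k x : UnitAddCircle) = a k (s x)
  right_coe : ∀ l x, (right l x : UnitAddCircle) = b l (s x)
  -- Where `a k` vanishes, `left k` is an integer, locally constant, so `area` moves with `left k`
  -- times the change of `right l`. Where `b l` vanishes, `area` is integral, so locally constant.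
  -- Where both vanish the product is an integer and the two conditions agree.
  area_of_left : ∀ k l x, a k (s x) = 0 →
    (area k l x : UnitAddCircle) = (left k x * right l x : ℝ)
  area_of_right : ∀ k l x, b l (s x) = 0 → (area k l x : UnitAddCircle) = 0

/-- The class of the matrix of increments of the area functions. -/
def LiftData.increment {s : C(K, Y)} (d : LiftData a b s) (x y : K) :
    (ℕ → ℕ → ℝ) ⧸ finiteRank :=
  finiteRank.mkQ fun k l => d.area k l y - d.area k l x

/-- Lift data pull back. -/
def LiftData.comp {s : C(K, Y)} (d : LiftData a b s) (f : C(K', K)) : LiftData a b (s.comp f) where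
  left k := (d.left k).comp f
  right l := (d.right l).comp f
  area k l := (d.area k l).comp f
  left_coe k x := d.left_coe k (f x)
  right_coe l x := d.right_coe l (f x)
  area_of_left k l x := d.area_of_left k l (f x)
  area_of_right k l x := d.area_of_right k l (f x)

theorem LiftData.increment_comp {s : C(K, Y)} (d : LiftData a b s) (f : C(K', K)) (x y : K') :
    (d.comp f).increment x y = d.increment (f x) (f y) := rfl

theorem LiftData.increment_add {s : C(K, Y)} (d : LiftData a b s) (x y z : K) :
    d.increment x y + d.increment y z = d.increment x z := by
  unfold increment
  rw [← map_add]
  congr 1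
  ext k l
  simp

theorem unitAddCircle_coe_eq_zero {x : ℝ} (hx : (x : UnitAddCircle) = 0) : ∃ n : ℤ, x = n := by
  obtain ⟨n, hn⟩ := (AddCircle.coe_eq_zero_iff (1 : ℝ)).1 hx
  exact ⟨n, by simpa using hn.symm⟩

theorem unitAddCircle_coe_int (n : ℤ) : ((n : ℝ) : UnitAddCircle) = 0 :=
  (AddCircle.coe_eq_zero_iff (1 : ℝ)).2 ⟨n, by simp⟩

theorem exists_int_of_coe_eq {x y : ℝ} (h : (x : UnitAddCircle) = y) : ∃ n : ℤ, x = y + n := by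
  obtain ⟨n, hn⟩ := unitAddCircle_coe_eq_zero (x := x - y) (by rw [AddCircle.coe_sub, h, sub_self])
  exact ⟨n, by linarith⟩

/-- Two lifts of `a k` differ by a constant integer `p k`, which changes the area by `p k` times the
increment of `right l`: a rank-one matrix. Changing the lift of `b l` by an integer changes the area
only by integers, hence by a constant. -/
theorem LiftData.increment_unique [PreconnectedSpace K] (hab : ∀ k l y, a k y = 0 ∨ b l y = 0)
    {s : C(K, Y)} (d e : LiftData a b s) (x y : K) : d.increment x y = e.increment x y := by
  have hconst : ∀ k, ∃ p : ℤ, ∀ z, d.left k z = e.left k z + p := by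
    intro k
    obtain ⟨p, hp⟩ := exists_int_of_coe_eq ((d.left_coe k x).trans (e.left_coe k x).symm)
    refine ⟨p, fun z => ?_⟩
    have := eq_of_forall_int (d.left k - e.left k) (fun w => by
      simp [d.left_coe, e.left_coe]) z x
    simp only [ContinuousMap.sub_apply] at this
    linarith
  choose p hp using hconst
  have key : ∀ k l, d.area k l y - d.area k l x - (e.area k l y - e.area k l x) =
      -- The combination `d.area - e.area - p k * e.right` is integral at every point, whichever
      -- coordinate vanishes there, so it is constant.
      p k * (e.right l y - e.right l x) := by
    intro k l
    have := eq_of_forall_int (d.area k l - e.area k l - (p k : ℝ) • e.right l) (fun w => by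
      obtain ⟨q, hq⟩ := exists_int_of_coe_eq ((d.right_coe l w).trans (e.right_coe l w).symm)
      simp only [ContinuousMap.sub_apply, ContinuousMap.smul_apply, smul_eq_mul,
        AddCircle.coe_sub]
      rcases hab k l (s w) with h | h
      · rw [d.area_of_left k l w h, e.area_of_left k l w h, ← AddCircle.coe_sub,
          ← AddCircle.coe_sub, hp k w, hq]
        obtain ⟨n, hn⟩ := unitAddCircle_coe_eq_zero ((e.left_coe k w).trans h)
        rw [hn, ← unitAddCircle_coe_int (n * q + p k * q)]
        congr 1
        push_cast
        ring
      · rw [d.area_of_right k l w h, e.area_of_right k l w h]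
        obtain ⟨n, hn⟩ := unitAddCircle_coe_eq_zero ((e.right_coe l w).trans h)
        rw [hn, sub_self, zero_sub, neg_eq_zero, ← unitAddCircle_coe_int (p k * n)]
        push_cast
        rfl) y x
    simp only [ContinuousMap.sub_apply, ContinuousMap.smul_apply, smul_eq_mul] at this
    linarith
  unfold increment
  rw [← sub_eq_zero, ← map_sub, Submodule.mkQ_apply, Submodule.Quotient.mk_eq_zero]
  refine Submodule.subset_span ⟨fun k => p k, fun l => e.right l y - e.right l x, ?_⟩
  ext k l
  exact key k l

/-- The two conditions on the area prescribe a circle-valued function on two closed sets covering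
`K`, consistently on the overlap. The pasted function is continuous, and contractibility lets it
lift to the line. -/
theorem exists_liftData [ContractibleSpace K] (hab : ∀ k l y, a k y = 0 ∨ b l y = 0)
    (s : C(K, Y)) : Nonempty (LiftData a b s) := by
  choose α hα using fun k => exists_real_lift ((a k).comp s)
  choose β hβ using fun l => exists_real_lift ((b l).comp s)
  classical
  let f : ℕ → ℕ → K → UnitAddCircle := fun k l x =>
    if a k (s x) = 0 then ((α k x * β l x : ℝ) : UnitAddCircle) else 0
  have hf0 : ∀ k l x, b l (s x) = 0 → f k l x = 0 := by
    intro k l x h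
    simp only [f]
    split_ifs with h'
    · obtain ⟨m, hm⟩ := unitAddCircle_coe_eq_zero ((hα k x).trans h')
      obtain ⟨n, hn⟩ := unitAddCircle_coe_eq_zero ((hβ l x).trans h)
      rw [hm, hn, ← unitAddCircle_coe_int (m * n)]
      push_cast
      rfl
    · rfl
  have hf : ∀ k l, Continuous (f k l) := by
    intro k l
    have h1 : IsClosed {x | a k (s x) = 0} :=
      isClosed_eq ((a k).continuous.comp s.continuous) continuous_const
    have h2 : IsClosed {x | b l (s x) = 0} :=
      isClosed_eq ((b l).continuous.comp s.continuous) continuous_const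
    rw [← continuousOn_univ]
    have hu : (Set.univ : Set K) = {x | a k (s x) = 0} ∪ {x | b l (s x) = 0} := by
      ext x
      simpa using hab k l (s x)
    rw [hu]
    refine ContinuousOn.union_of_isClosed ?_ ?_ h1 h2
    · refine ContinuousOn.congr (f := fun x => ((α k x * β l x : ℝ) : UnitAddCircle)) ?_
        fun x hx => if_pos hx
      exact ((AddCircle.continuous_mk' (1 : ℝ)).comp
        ((α k).continuous.mul (β l).continuous)).continuousOn
    · exact (continuousOn_const (c := (0 : UnitAddCircle))).congr fun x hx => hf0 k l x hx
  choose ζ hζ using fun k l => exists_real_lift (⟨f k l, hf k l⟩ : C(K, UnitAddCircle))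
  exact ⟨⟨α, β, ζ, hα, hβ, fun k l x h => (hζ k l x).trans (if_pos h),
    fun k l x h => (hζ k l x).trans (hf0 k l x h)⟩⟩

/-- The cocycle given by two families of circle-valued maps with disjoint supports. -/
def areaCocycle (a b : ℕ → C(Y, UnitAddCircle)) (hab : ∀ k l y, a k y = 0 ∨ b l y = 0) :
    Cocycle Y ((ℕ → ℕ → ℝ) ⧸ finiteRank) where
  val s := (exists_liftData hab s).some.increment (stdSimplex.vertex 0) (stdSimplex.vertex 1)
  cond s := by
    -- Independence of the lifts replaces the choices on the three faces by restrictions of one lift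
    -- on the 2-simplex; the increments then telescope along the vertices.
    have d := (exists_liftData hab s).some
    have hface : ∀ i j, simplexFace 1 i (stdSimplex.vertex j) = stdSimplex.vertex (i.succAbove j) :=
      fun i j => stdSimplex.map_vertex _ _
    rw [LiftData.increment_unique hab _ (d.comp (simplexFace 1 0)),
      LiftData.increment_unique hab _ (d.comp (simplexFace 1 1)),
      LiftData.increment_unique hab _ (d.comp (simplexFace 1 2))]
    simp only [LiftData.increment_comp, hface]
    have := d.increment_add (stdSimplex.vertex 0) (stdSimplex.vertex 1) (stdSimplex.vertex 2)
    have e1 : (0 : Fin 3).succAbove (0 : Fin 2) = 1 := rfl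
    have e2 : (0 : Fin 3).succAbove (1 : Fin 2) = 2 := rfl
    have e3 : (1 : Fin 3).succAbove (0 : Fin 2) = 0 := rfl
    have e4 : (1 : Fin 3).succAbove (1 : Fin 2) = 2 := rfl
    have e5 : (2 : Fin 3).succAbove (0 : Fin 2) = 0 := rfl
    have e6 : (2 : Fin 3).succAbove (1 : Fin 2) = 1 := rfl
    rw [e1, e2, e3, e4, e5, e6, ← this]
    abel

/-- By uniqueness, explicit lift data along the loop may replace the chosen ones; this makes the
invariant computable. -/
theorem areaCocycle_loopClass (hab : ∀ k l y, a k y = 0 ∨ b l y = 0) (γ : C(unitInterval, Y))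
    (hγ : γ 0 = γ 1) (d : LiftData a b γ) :
    (areaCocycle a b hab).homologyHom (loopClass γ hγ) = d.increment 0 1 := by
  rw [Cocycle.homologyHom_loopClass]
  refine (LiftData.increment_unique hab _ (d.comp _) _ _).trans ?_
  rfl

end LiftData

/-! ### Circle-valued coordinates on the ear-ring -/

open Classical in
/-- The coordinate of a point of the ear-ring on its `n`-th circle. -/
def coordFun (n : ℕ) : Earring → UnitAddCircle
  | none => 0
  | some y => if ⌊(y : ℝ)⌋ = (n : ℤ) then ((y : ℝ) : UnitAddCircle) else 0

theorem coordFun_coe (n : ℕ) (y : CutRay) : coordFun n (y : Earring) =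
    if ⌊(y : ℝ)⌋ = (n : ℤ) then ((y : ℝ) : UnitAddCircle) else 0 := by
  unfold coordFun
  congr

theorem norm_coe_le_of_int (x : ℝ) (z : ℤ) : ‖(x : UnitAddCircle)‖ ≤ |x - z| := by
  rw [UnitAddCircle.norm_eq]
  exact round_le x z

theorem continuous_coordFun (n : ℕ) : Continuous (coordFun n) := by
  rw [OnePoint.continuous_iff]
  constructor
  · rw [Metric.tendsto_nhds]
    intro ε hε
    -- Points of the `n`-th circle outside `K` lie within `min ε (1 / 2)` of an endpoint `n` or `n +
    -- 1`, so their class has norm below `ε`.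
    set K : Set CutRay := Subtype.val ⁻¹' Set.Icc ((n : ℝ) + min ε (1 / 2)) (n + 1 - min ε (1 / 2))
    have hm : 0 < min ε (1 / 2) := lt_min hε (by norm_num)
    have hK : IsCompact K := by
      rw [Subtype.isCompact_iff]
      have himg : Subtype.val '' K =
          Set.Icc ((n : ℝ) + min ε (1 / 2)) (n + 1 - min ε (1 / 2)) := by
        refine (Subtype.image_preimage_coe _ _).trans (Set.inter_eq_right.2 ?_)
        intro y hy
        have h0 : (0 : ℝ) ≤ n := n.cast_nonneg
        refine ⟨by linarith [hy.1], fun k hk => ?_⟩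
        have h1 : (n : ℝ) < k := by linarith [hy.1]
        have h2 : (k : ℝ) < n + 1 := by linarith [hy.2]
        have h1' : n < k := by exact_mod_cast h1
        have h2' : k < n + 1 := by exact_mod_cast h2
        omega
      rw [himg]
      exact isCompact_Icc
    have hKc : IsClosed K := isClosed_Icc.preimage continuous_subtype_val
    filter_upwards [hK.compl_mem_coclosedCompact_of_isClosed hKc] with y hy
    have h0 : coordFun n (OnePoint.infty : Earring) = 0 := rfl
    rw [h0, dist_zero_right, coordFun_coe]
    split_ifs with h
    · have h1 : (n : ℝ) ≤ y := by exact_mod_cast Int.le_floor.1 h.ge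
      have h2 : (y : ℝ) < n + 1 := by
        have := Int.lt_floor_add_one (y : ℝ)
        rw [h] at this
        exact_mod_cast this
      by_cases h3 : (n : ℝ) + min ε (1 / 2) ≤ y
      · have h4 : (n : ℝ) + 1 - min ε (1 / 2) < y := by
          by_contra h5
          exact hy ⟨h3, not_lt.1 h5⟩
        refine (norm_coe_le_of_int y (n + 1)).trans_lt ?_
        push_cast
        rw [abs_of_neg (by linarith)]
        linarith [min_le_left ε (1 / 2)]
      · refine (norm_coe_le_of_int y n).trans_lt ?_
        push_cast
        rw [abs_of_nonneg (by linarith)]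
        linarith [min_le_left ε (1 / 2)]
    · simpa using hε
  · rw [continuous_iff_continuousAt]
    intro y
    have h : ∀ᶠ z : CutRay in nhds y, ⌊(z : ℝ)⌋ = ⌊(y : ℝ)⌋ :=
      continuous_subtype_val.continuousAt.eventually
        (continuousAt_floor_real (not_int_of y.2.1 y.2.2))
    by_cases hy : ⌊(y : ℝ)⌋ = (n : ℤ)
    · refine ContinuousAt.congr (f := fun z : CutRay => ((z : ℝ) : UnitAddCircle)) ?_ ?_
      · exact ((AddCircle.continuous_mk' (1 : ℝ)).comp continuous_subtype_val).continuousAt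
      · filter_upwards [h] with z hz
        rw [coordFun_coe, if_pos (hz.trans hy)]
    · refine (continuousAt_const (y := (0 : UnitAddCircle))).congr ?_
      filter_upwards [h] with z hz
      rw [coordFun_coe, if_neg (fun h' => hy (hz.symm.trans h'))]

/-- The `n`-th coordinate as a continuous map. -/
def coord (n : ℕ) : C(Earring, UnitAddCircle) := ⟨coordFun n, continuous_coordFun n⟩

theorem coord_infty (n : ℕ) : coord n OnePoint.infty = 0 := rfl

theorem coord_coe (n : ℕ) (y : CutRay) : coord n (y : Earring) =
    if ⌊(y : ℝ)⌋ = (n : ℤ) then ((y : ℝ) : UnitAddCircle) else 0 := coordFun_coe n y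

theorem coord_disjoint {i j : ℕ} (hij : i ≠ j) (y : Earring) : coord i y = 0 ∨ coord j y = 0 := by
  induction y using OnePoint.rec with
  | infty => exact Or.inl rfl
  | coe y =>
    rw [coord_coe, coord_coe]
    by_cases h : ⌊(y : ℝ)⌋ = (i : ℤ)
    · right
      rw [if_neg]
      rw [h]
      exact_mod_cast hij
    · exact Or.inl (if_neg h)

theorem coe_cutRay_ne_zero (y : CutRay) : ((y : ℝ) : UnitAddCircle) ≠ 0 := by
  intro h
  obtain ⟨n, hn⟩ := unitAddCircle_coe_eq_zero h
  exact not_int_of y.2.1 y.2.2 n hn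

theorem exists_coord_ne_zero (y : CutRay) :
    ∃ n : ℕ, ⌊(y : ℝ)⌋ = (n : ℤ) ∧ coord n (y : Earring) = ((y : ℝ) : UnitAddCircle) := by
  obtain ⟨n, hn⟩ := Int.eq_ofNat_of_zero_le (Int.floor_nonneg.2 y.2.1.le)
  exact ⟨n, hn, by rw [coord_coe, if_pos hn]⟩

theorem coord_injective {y z : Earring} (h : ∀ n, coord n y = coord n z) : y = z := by
  induction y using OnePoint.rec with
  | infty =>
    induction z using OnePoint.rec with
    | infty => rfl
    | coe z =>
      obtain ⟨n, _, hn⟩ := exists_coord_ne_zero z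
      exact absurd (hn.symm.trans (h n).symm) (coe_cutRay_ne_zero z)
  | coe y =>
    obtain ⟨n, hf, hn⟩ := exists_coord_ne_zero y
    induction z using OnePoint.rec with
    | infty => exact absurd (hn.symm.trans (h n)) (coe_cutRay_ne_zero y)
    | coe z =>
      have h1 := h n
      rw [hn, coord_coe] at h1
      split_ifs at h1 with h2
      -- Both points lie on circle `n` and differ by an integer; equal floors make that integer 0.
      · obtain ⟨p, hp⟩ := exists_int_of_coe_eq h1
        have h3 : ⌊(y : ℝ)⌋ = ⌊(z : ℝ)⌋ + p := by rw [hp, Int.floor_add_intCast]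
        have h4 : p = 0 := by omega
        rw [h4] at hp
        congr 1
        exact Subtype.ext (by simpa using hp)
      · exact absurd h1 (coe_cutRay_ne_zero y)

/-- The ear-ring is compact and the coordinates are jointly injective into a Hausdorff product, so
they form a closed embedding. -/
theorem continuous_of_coord {Z : Type} [TopologicalSpace Z] {f : Z → Earring}
    (h : ∀ n, Continuous fun z => coord n (f z)) : Continuous f := by
  have hc : Continuous fun (y : Earring) (n : ℕ) => coord n y :=
    continuous_pi fun n => (coord n).continuous
  have he := hc.isClosedEmbedding fun y z hyz => coord_injective fun n => congrFun hyz n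
  rw [he.isInducing.continuous_iff]
  exact continuous_pi h

/-- Together with injectivity, this identifies the ear-ring with the sequences having at most one
nonzero coordinate. A nonzero class in position `n` has a representative strictly between `n` and `n
+ 1`. -/
theorem exists_coord_eq {u : ℕ → UnitAddCircle} (hu : ∀ i j, i ≠ j → u i = 0 ∨ u j = 0) :
    ∃ y : Earring, ∀ n, coord n y = u n := by
  by_cases h : ∀ n, u n = 0
  · exact ⟨OnePoint.infty, fun n => (h n).symm⟩
  · push Not at h
    obtain ⟨n, hn⟩ := h
    obtain ⟨r, hr⟩ := QuotientAddGroup.mk_surjective (u n)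
    have hr' : ((Int.fract r + n : ℝ) : UnitAddCircle) = u n := by
      rw [← hr]
      have : (((Int.fract r + n : ℝ) - r : ℝ) : UnitAddCircle) = 0 := by
        rw [← unitAddCircle_coe_int (n - ⌊r⌋)]
        congr 1
        push_cast
        rw [Int.fract]
        ring
      rw [AddCircle.coe_sub, sub_eq_zero] at this
      exact this
    have h0 : 0 < Int.fract r := by
      refine lt_of_le_of_ne (Int.fract_nonneg r) fun h0 => hn ?_
      rw [← hr', ← h0, zero_add]
      exact unitAddCircle_coe_int n
    have h1 := Int.fract_lt_one r
    have hmem : 0 < Int.fract r + n ∧ ∀ k : ℕ, Int.fract r + n ≠ k := by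
      refine ⟨by positivity, fun k hk => ?_⟩
      have h2 : (n : ℝ) < k := by linarith
      have h3 : (k : ℝ) < n + 1 := by linarith
      have h2' : n < k := by exact_mod_cast h2
      have h3' : k < n + 1 := by exact_mod_cast h3
      omega
    refine ⟨((⟨_, hmem⟩ : CutRay) : Earring), fun i => ?_⟩
    have hfl : ⌊Int.fract r + (n : ℝ)⌋ = n := by
      rw [Int.floor_add_natCast, Int.floor_fract, zero_add]
    rw [coord_coe]
    simp only [hfl]
    split_ifs with hi
    · have : n = i := by exact_mod_cast hi
      rw [hr', this]
    · refine ((hu n i ?_).resolve_left hn).symm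
      exact_mod_cast hi

/-- A map to the ear-ring whose coordinates lift to real functions with disjoint supports is
nullhomotopic. -/
theorem homotopic_const_of_lift {Z : Type} [TopologicalSpace Z] (f : C(Z, Earring))
    (u : ℕ → C(Z, ℝ)) (hu : ∀ i j, i ≠ j → ∀ z, u i z = 0 ∨ u j z = 0)
    (hf : ∀ n z, coord n (f z) = (u n z : UnitAddCircle)) :
    f.Homotopic (ContinuousMap.const Z OnePoint.infty) := by
  -- The homotopy shrinks all lifts linearly to 0. Disjoint supports leave at most one nonzero
  -- coordinate at each time, so the values stay in the ear-ring.
  have h : ∀ p : unitInterval × Z, ∃ y : Earring, ∀ n,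
      coord n y = (((1 - (p.1 : ℝ)) * u n p.2 : ℝ) : UnitAddCircle) := fun p =>
    exists_coord_eq fun i j hij => (hu i j hij p.2).imp (fun h => by simp [h]) fun h => by simp [h]
  choose H hH using h
  refine ⟨⟨⟨H, continuous_of_coord fun n => ?_⟩, fun z => ?_, fun z => ?_⟩⟩
  · simp only [hH]
    exact (AddCircle.continuous_mk' (1 : ℝ)).comp (by fun_prop)
  · refine coord_injective fun n => ?_
    change coord n (H (0, z)) = _
    rw [hH, hf]
    simp
  · refine coord_injective fun n => ?_
    change coord n (H (1, z)) = _
    rw [hH, ContinuousMap.const_apply, coord_infty]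
    simp

/-! ### Real lifts of the coordinates of `m` -/

/-- The function that decreases from `0` to `-1` on `[0, 1]` and increases back to `0` on
`[2, 3]`. -/
def dip (x : ℝ) : ℝ := -max 0 (min 1 (min x (3 - x)))

theorem continuous_dip : Continuous dip := by
  unfold dip
  fun_prop

theorem dip_of_le_zero {x : ℝ} (h : x ≤ 0) : dip x = 0 := by
  unfold dip
  rw [max_eq_left, neg_zero]
  exact (min_le_right _ _).trans ((min_le_left _ _).trans h)

theorem dip_of_three_le {x : ℝ} (h : 3 ≤ x) : dip x = 0 := by
  unfold dip
  rw [max_eq_left, neg_zero]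
  exact (min_le_right _ _).trans ((min_le_right _ _).trans (by linarith))

theorem dip_descending {x : ℝ} (h0 : 0 ≤ x) (h1 : x ≤ 1) : dip x = -x := by
  unfold dip
  rw [min_eq_left (by linarith : x ≤ 3 - x), min_eq_right h1, max_eq_right h0]

theorem dip_bottom {x : ℝ} (h0 : 1 ≤ x) (h1 : x ≤ 2) : dip x = -1 := by
  unfold dip
  rw [min_eq_left (le_min h0 (by linarith)), max_eq_right zero_le_one]

theorem dip_ascending {x : ℝ} (h0 : 2 ≤ x) (h1 : x ≤ 3) : dip x = x - 3 := by
  unfold dip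
  rw [min_eq_right (by linarith : 3 - x ≤ x), min_eq_right (by linarith),
    max_eq_right (by linarith)]
  ring

theorem dip_int (z : ℤ) : ∃ p : ℤ, dip z = p := by
  refine ⟨-max 0 (min 1 (min z (3 - z))), ?_⟩
  unfold dip
  push_cast
  rfl

/-- The point of the ray at which the circle number `n` starts to be traversed by `m`. -/
def start (n : ℕ) : ℕ := 4 * (n / 2) + n % 2

/-- The real lift of the coordinate of `m` on the circle number `n`. -/
def liftFun (n : ℕ) : RayCircle → ℝ
  | none => 0
  | some x => dip (x - start n)

theorem liftFun_coe (n : ℕ) (x : {x : ℝ // 0 < x}) :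
    liftFun n (x : RayCircle) = dip (x - start n) := rfl

theorem continuous_liftFun (n : ℕ) : Continuous (liftFun n) := by
  rw [OnePoint.continuous_iff]
  constructor
  · rw [Metric.tendsto_nhds]
    intro ε hε
    set K : Set {x : ℝ // 0 < x} := Subtype.val ⁻¹' Set.Icc ε (start n + 3)
    have hK : IsCompact K := by
      rw [Subtype.isCompact_iff]
      have himg : Subtype.val '' K = Set.Icc ε (start n + 3) := by
        refine (Subtype.image_preimage_coe _ _).trans (Set.inter_eq_right.2 ?_)
        exact fun y hy => hε.trans_le hy.1
      rw [himg]
      exact isCompact_Icc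
    have hKc : IsClosed K := isClosed_Icc.preimage continuous_subtype_val
    filter_upwards [hK.compl_mem_coclosedCompact_of_isClosed hKc] with x hx
    have h0 : liftFun n (OnePoint.infty : RayCircle) = 0 := rfl
    rw [h0, liftFun_coe, dist_zero_right, Real.norm_eq_abs]
    have hs : (0 : ℝ) ≤ start n := Nat.cast_nonneg _
    by_cases h1 : ε ≤ (x : ℝ)
    · rw [dip_of_three_le]
      · simpa using hε
      · have : ¬ (x : ℝ) ≤ start n + 3 := fun h2 => hx ⟨h1, h2⟩
        linarith
    · unfold dip
      rw [abs_neg, abs_of_nonneg (le_max_left _ _)]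
      refine max_lt hε ?_
      refine ((min_le_right _ _).trans (min_le_left _ _)).trans_lt ?_
      linarith
  · exact continuous_dip.comp (continuous_subtype_val.sub continuous_const)

/-- The real lift of the coordinate of `m` on the circle number `n`, as a continuous map. -/
def liftMap (n : ℕ) : C(RayCircle, ℝ) := ⟨liftFun n, continuous_liftFun n⟩

theorem liftMap_coe (n : ℕ) (x : {x : ℝ // 0 < x}) :
    liftMap n (x : RayCircle) = dip (x - start n) := rfl

theorem liftMap_infty (n : ℕ) : liftMap n OnePoint.infty = 0 := rfl

theorem start_even (k : ℕ) : start (2 * k) = 4 * k := by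
  unfold start
  omega

theorem start_odd (k : ℕ) : start (2 * k + 1) = 4 * k + 1 := by
  unfold start
  omega

/-- Circles `2k` and `2k + 1` are active only during the block `[4k, 4k + 4]`. Within one block the
two lifts do overlap, hence the hypothesis on halves. -/
theorem liftMap_disjoint {i j : ℕ} (h : i / 2 ≠ j / 2) (x : RayCircle) :
    liftMap i x = 0 ∨ liftMap j x = 0 := by
  wlog hij : i / 2 < j / 2 generalizing i j
  · exact (this h.symm (by omega)).symm
  induction x using OnePoint.rec with
  | infty => exact Or.inl rfl
  | coe x =>
    rw [liftMap_coe, liftMap_coe]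
    have h1 : start i + 3 ≤ start j := by
      unfold start
      omega
    have h1' : (start i : ℝ) + 3 ≤ start j := by exact_mod_cast h1
    rcases le_total ((start i : ℝ) + 3) x with h2 | h2
    · exact Or.inl (dip_of_three_le (by linarith))
    · exact Or.inr (dip_of_le_zero (by linarith))

theorem floor_cast_of_mem {z : ℤ} {y : ℝ} (h0 : (z : ℝ) ≤ y) (h1 : y < z + 1) : ⌊y⌋ = z :=
  Int.floor_eq_iff.2 ⟨h0, h1⟩

theorem fract_neg_of_mem {z : ℤ} {x : ℝ} (h0 : (z : ℝ) < x) (h1 : x < z + 1) :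
    Int.fract (-x) = z + 1 - x := by
  rw [Int.fract, floor_cast_of_mem (z := -z - 1) (by push_cast; linarith) (by push_cast; linarith)]
  push_cast
  ring

/-- The values of `mReal` on the four intervals of a period. -/
theorem mReal_period (j : ℤ) {r : ℤ} {x : ℝ} (h0 : ((4 * j + r : ℤ) : ℝ) < x)
    (h1 : x < ((4 * j + r : ℤ) : ℝ) + 1) :
    (r = 0 → mReal x = 6 * j + 1 - x) ∧ (r = 1 → mReal x = 6 * j + 3 - x) ∧
    (r = 2 → mReal x = x - 2 * j - 2) ∧ (r = 3 → mReal x = x - 2 * j - 2) := by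
  have hf := fract_neg_of_mem h0 h1
  push_cast at h0 h1 hf
  have he : Even (2 * j) := even_two_mul j
  have ho : Odd (2 * j + 1) := odd_two_mul_add_one j
  -- The cases traverse circle `2j` backwards, `2j+1` backwards, `2j` forwards, `2j+1` forwards: one
  -- commutator per period.
  refine ⟨?_, ?_, ?_, ?_⟩ <;> rintro rfl <;> unfold mReal <;> rw [hf] <;>
    push_cast at h0 h1 ⊢
  · rw [floor_cast_of_mem (z := 2 * j) (y := (x + 1) / 2), floor_cast_of_mem (z := 2 * j),
      he.neg_one_zpow]
    all_goals (push_cast; linarith)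
  · rw [floor_cast_of_mem (z := 2 * j + 1) (y := (x + 1) / 2), floor_cast_of_mem (z := 2 * j),
      he.neg_one_zpow]
    all_goals (push_cast; linarith)
  · rw [floor_cast_of_mem (z := 2 * j + 1) (y := (x + 1) / 2),
      floor_cast_of_mem (z := 2 * j + 1), ho.neg_one_zpow]
    all_goals (push_cast; linarith)
  · rw [floor_cast_of_mem (z := 2 * j + 2) (y := (x + 1) / 2),
      floor_cast_of_mem (z := 2 * j + 1), ho.neg_one_zpow]
    all_goals (push_cast; linarith)

theorem coe_eq_of_int {x y : ℝ} (n : ℤ) (h : x = y + n) : (x : UnitAddCircle) = y := by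
  rw [h, AddCircle.coe_add, unitAddCircle_coe_int, add_zero]

open Classical in
theorem mMap_coe (x : {x : ℝ // 0 < x}) : mMap (x : RayCircle) =
    if h : ∀ n : ℕ, (x : ℝ) ≠ n then
      ((⟨mReal x, mReal_mem x.2 h⟩ : CutRay) : Earring) else OnePoint.infty := rfl

/-- `liftMap n` lifts the `n`-th coordinate of `m`. -/
theorem coord_mMap (n : ℕ) (x : RayCircle) : coord n (mMap x) = (liftMap n x : UnitAddCircle) := by
  induction x using OnePoint.rec with
  | infty => exact (unitAddCircle_coe_int 0).symm.trans (by rw [Int.cast_zero]; rfl)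
  | coe x =>
    rw [liftMap_coe, mMap_coe]
    split_ifs with h
    · rw [coord_coe]
      simp only
      obtain ⟨N, hN⟩ := Int.eq_ofNat_of_zero_le (Int.floor_nonneg.2 x.2.le)
      have hx0 : (N : ℝ) < x := by
        refine lt_of_le_of_ne ?_ (h N).symm
        have := Int.floor_le (x : ℝ)
        rw [hN] at this
        exact_mod_cast this
      have hx1 : (x : ℝ) < N + 1 := by
        have := Int.lt_floor_add_one (x : ℝ)
        rw [hN] at this
        exact_mod_cast this
      obtain ⟨j, r, hr, rfl⟩ : ∃ j r : ℕ, r < 4 ∧ N = 4 * j + r :=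
        ⟨N / 4, N % 4, Nat.mod_lt _ (by norm_num), (Nat.div_add_mod _ _).symm⟩
      push_cast at hx0 hx1
      have hm := mReal_period (j : ℤ) (r := r) (x := x) (by push_cast; linarith)
        (by push_cast; linarith)
      by_cases hn : n / 2 = j
      · have hs : ∀ i : ℕ, i < 2 → (start (2 * j + i) : ℝ) = 4 * j + i := by
          intro i hi
          have : start (2 * j + i) = 4 * j + i := by
            unfold start
            omega
          rw [this]
          push_cast
          rfl
        have hs0 := hs 0 (by norm_num)
        have hs1 := hs 1 (by norm_num)
        obtain ⟨m0, m1, m2, m3⟩ := hm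
        push_cast at m0 m1 m2 m3 hs0 hs1
        have hn' : n = 2 * j + 0 ∨ n = 2 * j + 1 := by omega
        -- `hpos` treats the circle on which `m(x)` lies, where the lift equals `mReal x` up to an
        -- integer; `hneg` treats the other circle of the pair, where the lift rests at 0 or -1.
        have hpos : ∀ (i : ℕ) (y z : ℝ) (p : ℤ), mReal x = y → (2 * j + i : ℝ) ≤ y →
            y < 2 * j + i + 1 → y = z + p → ∀ i', i' = i →
            (if ⌊mReal x⌋ = ((2 * j + i' : ℕ) : ℤ) then (mReal x : UnitAddCircle) else 0) = z := by
          rintro i y z p hy h1 h2 h3 _ rfl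
          rw [if_pos, hy]
          · exact coe_eq_of_int p h3
          · rw [hy]
            exact floor_cast_of_mem (by push_cast; exact h1) (by push_cast; exact h2)
        have hneg : ∀ (i : ℕ) (y z : ℝ) (p : ℤ), mReal x = y → (2 * j + i : ℝ) ≤ y →
            y < 2 * j + i + 1 → z = p → ∀ i', i' ≠ i →
            (if ⌊mReal x⌋ = ((2 * j + i' : ℕ) : ℤ) then (mReal x : UnitAddCircle) else 0) = z := by
          intro i y z p hy h1 h2 h3 i' hi
          rw [if_neg, h3, unitAddCircle_coe_int]
          rw [hy, floor_cast_of_mem (z := ((2 * j + i : ℕ) : ℤ)) (by push_cast; exact h1)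
            (by push_cast; exact h2)]
          intro h4
          have : 2 * j + i = 2 * j + i' := by exact_mod_cast h4
          omega
        have hr4 : r = 0 ∨ r = 1 ∨ r = 2 ∨ r = 3 := by omega
        rcases hr4 with rfl | rfl | rfl | rfl <;> push_cast at hx0 hx1 <;>
          rcases hn' with rfl | rfl
        · refine hpos 0 _ _ (2 * j + 1) (m0 rfl) ?_ ?_ ?_ 0 rfl
          · push_cast; linarith
          · push_cast; linarith
          · rw [dip_descending] <;> push_cast <;> linarith
        · refine hneg 0 _ _ 0 (m0 rfl) ?_ ?_ ?_ 1 one_ne_zero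
          · push_cast; linarith
          · push_cast; linarith
          · rw [dip_of_le_zero] <;> push_cast <;> linarith
        · refine hneg 1 _ _ (-1) (m1 rfl) ?_ ?_ ?_ 0 zero_ne_one
          · push_cast; linarith
          · push_cast; linarith
          · rw [dip_bottom] <;> push_cast <;> linarith
        · refine hpos 1 _ _ (2 * j + 2) (m1 rfl) ?_ ?_ ?_ 1 rfl
          · push_cast; linarith
          · push_cast; linarith
          · rw [dip_descending] <;> push_cast <;> linarith
        · refine hpos 0 _ _ (2 * j + 1) (m2 rfl) ?_ ?_ ?_ 0 rfl
          · push_cast; linarith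
          · push_cast; linarith
          · rw [dip_ascending] <;> push_cast <;> linarith
        · refine hneg 0 _ _ (-1) (m2 rfl) ?_ ?_ ?_ 1 one_ne_zero
          · push_cast; linarith
          · push_cast; linarith
          · rw [dip_bottom] <;> push_cast <;> linarith
        · refine hneg 1 _ _ 0 (m3 rfl) ?_ ?_ ?_ 0 zero_ne_one
          · push_cast; linarith
          · push_cast; linarith
          · rw [dip_of_three_le] <;> push_cast <;> linarith
        · refine hpos 1 _ _ (2 * j + 2) (m3 rfl) ?_ ?_ ?_ 1 rfl
          · push_cast; linarith
          · push_cast; linarith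
          · rw [dip_ascending] <;> push_cast <;> linarith
      · have hdip : dip (x - start n) = 0 := by
          rcases lt_or_gt_of_ne hn with h1 | h1
          · have h2 : start n + 3 ≤ 4 * j := by
              unfold start
              omega
            have h2' : (start n : ℝ) + 3 ≤ 4 * j := by exact_mod_cast h2
            have hr0 : (0 : ℝ) ≤ r := r.cast_nonneg
            exact dip_of_three_le (by linarith)
          · have h2 : 4 * j + r + 1 ≤ start n := by
              unfold start
              omega
            have h2' : (4 * j + r + 1 : ℝ) ≤ start n := by exact_mod_cast h2
            exact dip_of_le_zero (by linarith)
        rw [hdip, if_neg]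
        · exact (unitAddCircle_coe_int 0).symm.trans (by rw [Int.cast_zero])
        · obtain ⟨m0, m1, m2, m3⟩ := hm
          push_cast at m0 m1 m2 m3
          have hb : (2 * j : ℝ) ≤ mReal x ∧ mReal x < 2 * j + 2 := by
            have hr4 : r = 0 ∨ r = 1 ∨ r = 2 ∨ r = 3 := by omega
            rcases hr4 with rfl | rfl | rfl | rfl <;> push_cast at hx0 hx1
            · rw [m0 rfl]
              constructor <;> linarith
            · rw [m1 rfl]
              constructor <;> linarith
            · rw [m2 rfl]
              constructor <;> linarith
            · rw [m3 rfl]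
              constructor <;> linarith
          intro hfl
          have h1 : (n : ℤ) < 2 * j + 2 := by
            rw [← hfl]
            exact Int.floor_lt.2 (by push_cast; exact hb.2)
          have h2 : (2 * j : ℤ) ≤ n := by
            rw [← hfl]
            exact Int.le_floor.2 (by push_cast; exact hb.1)
          omega
    -- At a natural number `m` passes through `∞`, and the dip takes an integral value.
    · push Not at h
      obtain ⟨k, hk⟩ := h
      obtain ⟨p, hp⟩ := dip_int (k - start n)
      rw [coord_infty, hk]
      push_cast at hp
      rw [hp, unitAddCircle_coe_int]

/-! ### The area matrix of `m` and the resulting functional -/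

/-- The function that is `0` before time `c`, `1` after time `c + 1` and linear in between, in the
parametrization `t / (1 - t)` of the circle. -/
def ramp (c : ℕ) : C(unitInterval, ℝ) where
  -- The cap `(c + 1) / (c + 2)` solves `t / (1 - t) = c + 1`, where the ramp has already reached 1;
  -- it avoids the pole at `t = 1`.
  toFun t := max 0 (min 1 (min (t : ℝ) ((c + 1) / (c + 2)) /
    (1 - min (t : ℝ) ((c + 1) / (c + 2))) - c))
  continuous_toFun := by
    have h : ∀ t : unitInterval, 1 - min (t : ℝ) ((c + 1) / (c + 2)) ≠ 0 := by
      intro t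
      have h1 : ((c : ℝ) + 1) / (c + 2) < 1 := by
        rw [div_lt_one (by positivity)]
        linarith
      linarith [min_le_right (t : ℝ) ((c + 1) / (c + 2))]
    have h2 : Continuous fun t : unitInterval => min (t : ℝ) ((c + 1) / (c + 2)) := by fun_prop
    exact continuous_const.max (continuous_const.min
      ((h2.div (continuous_const.sub h2) h).sub continuous_const))

theorem ramp_of_lt (c : ℕ) (t : unitInterval) (ht : (t : ℝ) < 1) :
    ramp c t = max 0 (min 1 ((t : ℝ) / (1 - t) - c)) := by
  have h2 : (0 : ℝ) < c + 2 := by positivity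
  change max 0 (min 1 (min (t : ℝ) ((c + 1) / (c + 2)) /
    (1 - min (t : ℝ) ((c + 1) / (c + 2))) - c)) = _
  rcases le_total (t : ℝ) ((c + 1) / (c + 2)) with h | h
  · rw [min_eq_left h]
  · rw [min_eq_right h]
    have h3 : ((c : ℝ) + 1) / (c + 2) / (1 - (c + 1) / (c + 2)) - c = 1 := by
      field_simp
      ring
    have h4 : 1 ≤ (t : ℝ) / (1 - t) - c := by
      rw [div_le_iff₀ h2] at h
      rw [le_sub_iff_add_le, le_div_iff₀ (by linarith)]
      linarith
    rw [h3, min_self, min_eq_left h4]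

theorem ramp_zero (c : ℕ) : ramp c 0 = 0 := by
  rw [ramp_of_lt c 0 (by simp)]
  have h : (0 : ℝ) ≤ c := c.cast_nonneg
  simp [h]

theorem ramp_one (c : ℕ) : ramp c 1 = 1 := by
  have h2 : (0 : ℝ) < c + 2 := by positivity
  have h1 : ((c : ℝ) + 1) / (c + 2) ≤ 1 := by
    rw [div_le_one h2]
    linarith
  change max 0 (min 1 (min (((1 : unitInterval) : ℝ)) ((c + 1) / (c + 2)) /
    (1 - min (((1 : unitInterval) : ℝ)) ((c + 1) / (c + 2))) - c)) = _
  rw [Set.Icc.coe_one, min_eq_right h1]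
  have h3 : ((c : ℝ) + 1) / (c + 2) / (1 - (c + 1) / (c + 2)) - c = 1 := by
    field_simp
    ring
  rw [h3]
  simp

theorem stdLoop_of_mem {t : unitInterval} (h : 0 < (t : ℝ) ∧ (t : ℝ) < 1) : stdLoop t =
    ((⟨(t : ℝ) / (1 - t), div_pos h.1 (sub_pos.2 h.2)⟩ : {x : ℝ // 0 < x}) : RayCircle) :=
  dif_pos h

theorem stdLoop_of_notMem {t : unitInterval} (h : ¬ (0 < (t : ℝ) ∧ (t : ℝ) < 1)) :
    stdLoop t = OnePoint.infty :=
  dif_neg h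

/-- Integrality relations between two consecutive dips and a ramp. -/
theorem ramp_dip (x : ℝ) :
    (∀ n : ℤ, dip x = n → ∃ p : ℤ, max 0 (min 1 (x - 1)) = dip x * dip (x - 1) + p) ∧
    (∀ n : ℤ, dip (x - 1) = n → ∃ p : ℤ, max 0 (min 1 (x - 1)) = p) := by
  -- The area changes only on `[1, 2]`, where the first dip rests at -1 and the second falls from 0
  -- to -1, a gain of 1. When the second climbs back on `[3, 4]`, the first is already 0.
  rcases le_total x 1 with h1 | h1
  · have h2 : max 0 (min 1 (x - 1)) = 0 := max_eq_left ((min_le_right _ _).trans (by linarith))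
    rw [h2, dip_of_le_zero (by linarith : x - 1 ≤ 0)]
    exact ⟨fun n _ => ⟨0, by simp⟩, fun n _ => ⟨0, by simp⟩⟩
  rcases le_total x 2 with h2 | h2
  · have h3 : max 0 (min 1 (x - 1)) = x - 1 := by
      rw [min_eq_right (by linarith), max_eq_right (by linarith)]
    rw [h3, dip_bottom h1 h2, dip_descending (by linarith) (by linarith)]
    refine ⟨fun n _ => ⟨0, by simp⟩, fun n hn => ⟨-n, ?_⟩⟩
    push_cast
    linarith
  · have h3 : max 0 (min 1 (x - 1)) = 1 := by
      rw [min_eq_left (by linarith), max_eq_right zero_le_one]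
    rw [h3]
    refine ⟨fun n hn => ?_, fun _ _ => ⟨1, by simp⟩⟩
    rcases le_total x 3 with h4 | h4
    · rw [dip_bottom (by linarith : 1 ≤ x - 1) (by linarith), hn]
      exact ⟨1 + n, by push_cast; ring⟩
    · rw [dip_of_three_le h4]
      exact ⟨1, by simp⟩

theorem unitAddCircle_coe_zero : ((0 : ℝ) : UnitAddCircle) = 0 := by
  simp

theorem liftMap_consecutive (k : ℕ) (t : unitInterval) :
    (coord (2 * k) (mMap (stdLoop t)) = 0 → (ramp (4 * k + 1) t : UnitAddCircle) =
      (liftMap (2 * k) (stdLoop t) * liftMap (2 * k + 1) (stdLoop t) : ℝ)) ∧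
    (coord (2 * k + 1) (mMap (stdLoop t)) = 0 → (ramp (4 * k + 1) t : UnitAddCircle) = 0) := by
  rw [coord_mMap, coord_mMap]
  by_cases ht : 0 < (t : ℝ) ∧ (t : ℝ) < 1
  · rw [stdLoop_of_mem ht, liftMap_coe, liftMap_coe, ramp_of_lt _ _ ht.2, start_even, start_odd]
    simp only
    obtain ⟨h1, h2⟩ := ramp_dip ((t : ℝ) / (1 - t) - (4 * k : ℕ))
    have e : (t : ℝ) / (1 - t) - ((4 * k + 1 : ℕ) : ℝ) = t / (1 - t) - (4 * k : ℕ) - 1 := by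
      push_cast
      ring
    rw [e]
    constructor
    · intro h
      obtain ⟨n, hn⟩ := unitAddCircle_coe_eq_zero h
      obtain ⟨p, hp⟩ := h1 n hn
      exact coe_eq_of_int p hp
    · intro h
      obtain ⟨n, hn⟩ := unitAddCircle_coe_eq_zero h
      obtain ⟨p, hp⟩ := h2 n hn
      rw [hp, unitAddCircle_coe_int]
  · have h : ∃ p : ℤ, ramp (4 * k + 1) t = p := by
      by_cases h0 : 0 < (t : ℝ)
      · have : t = 1 := Subtype.ext (le_antisymm t.2.2 (not_lt.1 fun h => ht ⟨h0, h⟩))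
        exact ⟨1, by rw [this, ramp_one]; simp⟩
      · have : t = 0 := Subtype.ext (le_antisymm (not_lt.1 h0) t.2.1)
        exact ⟨0, by rw [this, ramp_zero]; simp⟩
    obtain ⟨p, hp⟩ := h
    rw [stdLoop_of_notMem ht, liftMap_infty, liftMap_infty, hp, unitAddCircle_coe_int, mul_zero,
      unitAddCircle_coe_zero]
    exact ⟨fun _ => rfl, fun _ => rfl⟩

theorem area_ne {k l : ℕ} (h : k ≠ l) (x : RayCircle) :
    liftMap (2 * k) x = 0 ∨ liftMap (2 * l + 1) x = 0 :=
  liftMap_disjoint (by omega) x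

/-- The lift data of the loop `m`. -/
def mLiftData : LiftData (fun k => coord (2 * k)) (fun l => coord (2 * l + 1))
    (mMap.comp stdLoop) where
  left k := (liftMap (2 * k)).comp stdLoop
  right l := (liftMap (2 * l + 1)).comp stdLoop
  -- Off the diagonal the two lifts are active in different blocks, so their product, and with it
  -- the area, is zero.
  area k l := if k = l then ramp (4 * k + 1) else 0
  left_coe k t := (coord_mMap _ _).symm
  right_coe l t := (coord_mMap _ _).symm
  area_of_left k l t h := by
    by_cases hkl : k = l
    · subst hkl
      rw [if_pos rfl]
      exact (liftMap_consecutive k t).1 h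
    · rw [if_neg hkl]
      have : liftMap (2 * k) (stdLoop t) * liftMap (2 * l + 1) (stdLoop t) = 0 :=
        mul_eq_zero.2 (area_ne hkl _)
      simp only [ContinuousMap.comp_apply, this, ContinuousMap.zero_apply]
  area_of_right k l t h := by
    by_cases hkl : k = l
    · subst hkl
      rw [if_pos rfl]
      exact (liftMap_consecutive k t).2 h
    · rw [if_neg hkl]
      exact unitAddCircle_coe_zero

theorem coord_even_odd (k l : ℕ) (y : Earring) : coord (2 * k) y = 0 ∨ coord (2 * l + 1) y = 0 :=
  coord_disjoint (by omega) y

/-- The homomorphism from `H₁` of the ear-ring to infinite matrices modulo those of finite rank. -/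
def areaHom : H1 Earring →+ (ℕ → ℕ → ℝ) ⧸ finiteRank :=
  (areaCocycle (fun k => coord (2 * k)) (fun l => coord (2 * l + 1)) coord_even_odd).homologyHom

/-- Every diagonal ramp rises from 0 to 1, so the matrix of increments is the identity. -/
theorem areaHom_m_ne_zero : areaHom (H1map mMap fundClass) ≠ 0 := by
  unfold fundClass areaHom
  rw [H1map_loopClass, areaCocycle_loopClass _ _ _ mLiftData]
  unfold LiftData.increment
  rw [Submodule.mkQ_apply, ne_eq, Submodule.Quotient.mk_eq_zero]
  convert! identity_notMem_finiteRank using 4 with k l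
  simp only [mLiftData]
  split_ifs
  · rw [ramp_one, ramp_zero, sub_zero]
  · simp

theorem nsmul_m_ne_zero (n : ℕ) (hn : 0 < n) : n • H1map mMap fundClass ≠ 0 := by
  intro h
  have h1 := congrArg areaHom h
  rw [map_nsmul, map_zero, ← Nat.cast_smul_eq_nsmul ℝ, smul_eq_zero] at h1
  rcases h1 with h1 | h1
  · exact hn.ne' (by exact_mod_cast h1)
  · exact areaHom_m_ne_zero h1

theorem exists_functional : ∃ k : H1 Earring →+ ℚ, k (H1map mMap fundClass) = 1 := by
  -- The rational line through the nonzero area class is a direct summand over `ℚ`; the functional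
  -- is a retraction onto it.
  obtain ⟨f, hf⟩ := LinearMap.exists_leftInverse_of_injective
    (LinearMap.toSpanSingleton ℚ ((ℕ → ℕ → ℝ) ⧸ finiteRank) (areaHom (H1map mMap fundClass)))
    (LinearMap.ker_toSpanSingleton ℚ areaHom_m_ne_zero)
  refine ⟨f.toAddMonoidHom.comp areaHom, ?_⟩
  have := LinearMap.congr_fun hf 1
  simpa using this

/-! ### The maps `a_ij` and the failure of straightness -/

theorem coord_aMap (i j : Fin 2) (n : ℕ) (x : RayCircle) : coord n (aMap i j x) =
    if Odd n then (if j = 1 then 0 else coord n (mMap x))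
    else (if i = 1 then 0 else coord n (mMap x)) := by
  have h : ∀ y : Earring, coord n (rFun i j y) = if Odd n then (if j = 1 then 0 else coord n y)
      else (if i = 1 then 0 else coord n y) := by
    intro y
    induction y using OnePoint.rec with
    | infty =>
      have : rFun i j OnePoint.infty = OnePoint.infty := rfl
      rw [this, coord_infty]
      simp
    | coe y =>
      rw [rFun_coe]
      unfold dropIf
      by_cases hn : ⌊(y : ℝ)⌋ = (n : ℤ)
      · have hodd : Odd ⌊(y : ℝ)⌋ ↔ Odd n := by rw [hn, Int.odd_coe_nat]
        simp only [hodd]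
        split_ifs <;> simp [coord_infty]
      · have h0 : coord n (y : Earring) = 0 := by rw [coord_coe, if_neg hn]
        split_ifs <;> simp [coord_infty, h0]
  exact h (mMap x)

theorem aMap_zero_zero : aMap 0 0 = mMap := by
  ext x
  exact coord_injective fun n => by simp [coord_aMap]

/-- Only the two lifts within one block overlap, and they have opposite parity. Killing one parity
makes the remaining supports disjoint, so the lifts can be shrunk to 0. -/
theorem aMap_homotopic_const (i j : Fin 2) (hij : i = 1 ∨ j = 1) :
    (aMap i j).Homotopic (ContinuousMap.const RayCircle OnePoint.infty) := by
  refine homotopic_const_of_lift _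
    (fun n => if Odd n then (if j = 1 then 0 else liftMap n)
      else (if i = 1 then 0 else liftMap n)) ?_ ?_
  · intro p q hpq x
    by_cases h : p / 2 = q / 2
    · rcases Nat.even_or_odd p with hp | hp <;> rcases Nat.even_or_odd q with hq | hq
      · obtain ⟨u, rfl⟩ := hp
        obtain ⟨v, rfl⟩ := hq
        omega
      · rcases hij with rfl | rfl <;> simp [hq, Nat.not_odd_iff_even.2 hp]
      · rcases hij with rfl | rfl <;> simp [hp, Nat.not_odd_iff_even.2 hq]
      · obtain ⟨u, rfl⟩ := hp
        obtain ⟨v, rfl⟩ := hq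
        omega
    · rcases liftMap_disjoint h x with h | h
      · left
        split_ifs <;> simp [h]
      · right
        split_ifs <;> simp [h]
  · intro n x
    rw [coord_aMap, coord_mMap]
    split_ifs <;> simp

theorem H1map_aMap (i j : Fin 2) (hij : i = 1 ∨ j = 1) : H1map (aMap i j) = 0 :=
  (H1map_homotopic (aMap_homotopic_const i j hij)).trans (H1map_const _)

theorem evalHom_mainInv {X Y : Type} [TopologicalSpace X] [TopologicalSpace Y] (e : H1 X)
    (k : H1 Y →+ ℚ) (a : C(X, Y)) : evalHom e k (mainInv X Y (cls a)) = k (H1map a e) :=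
  congrArg (fun f => k (f e)) (H1chain_mainInv a)

theorem vee_evalHom (k : H1 Earring →+ ℚ) (hk : k (H1map mMap fundClass) = 1) :
    vee (fun i j => evalHom fundClass k (mainInv RayCircle Earring (cls (aMap i j)))) = 1 := by
  simp only [vee]
  rw [evalHom_mainInv, evalHom_mainInv, evalHom_mainInv, evalHom_mainInv, aMap_zero_zero,
    H1map_aMap 1 0 (Or.inl rfl), H1map_aMap 0 1 (Or.inr rfl), H1map_aMap 1 1 (Or.inr rfl), hk]
  simp

theorem vee_bracket : vee (fun i j => bracket (aMap i j)) = 0 := by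
  apply Subtype.ext
  refine Finsupp.addHom_ext' fun x => AddMonoidHom.ext_int ?_
  have hb : ∀ i j, (bracket (aMap i j)).1 (Finsupp.single x 1) =
      Finsupp.single (aMap i j x) 1 := fun i j => Finsupp.mapDomain_single
  simp only [vee, AddSubgroup.coe_add, AddSubgroup.coe_sub, AddMonoidHom.comp_apply,
    AddMonoidHom.add_apply, AddMonoidHom.sub_apply, Finsupp.singleAddHom_apply]
  rw [hb, hb, hb, hb]
  -- If `m(x)` lies on an odd circle the value does not depend on `i`; otherwise it does not depend
  -- on `j`. Either way the four terms cancel in pairs.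
  have h : (aMap 0 0 x = aMap 1 0 x ∧ aMap 0 1 x = aMap 1 1 x) ∨
      (aMap 0 0 x = aMap 0 1 x ∧ aMap 1 0 x = aMap 1 1 x) := by
    by_cases hodd : ∃ n, Odd n ∧ coord n (mMap x) ≠ 0
    · obtain ⟨n, hn, hne⟩ := hodd
      have h0 : ∀ p, ¬ Odd p → coord p (mMap x) = 0 := fun p hp =>
        (coord_disjoint (j := n) (by rintro rfl; exact hp hn) _).resolve_right hne
      left
      constructor <;> refine coord_injective fun p => ?_ <;>
        rw [coord_aMap, coord_aMap] <;> split_ifs <;> simp_all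
    · push Not at hodd
      right
      constructor <;> refine coord_injective fun p => ?_ <;>
        rw [coord_aMap, coord_aMap] <;> split_ifs <;> simp_all
  rcases h with ⟨h1, h2⟩ | ⟨h1, h2⟩
  · rw [h1, h2]
    simp
  · rw [h1, h2]
    simp

/-- A straight invariant respects the relation `⋁ ⟨a_ij⟩ = 0`. -/
theorem IsStraight.vee_eq_zero {M : Type} [AddCommGroup M]
    {f : HtpyClasses RayCircle Earring → M} (hf : IsStraight f) :
    vee (fun i j => f (cls (aMap i j))) = 0 := by
  obtain ⟨F, hF⟩ := hf
  simp only [hF]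
  have := congrArg F vee_bracket
  simpa [vee] using this

theorem not_isStraight_evalHom (k : H1 Earring →+ ℚ) (hk : k (H1map mMap fundClass) = 1) :
    ¬ IsStraight (fun c : HtpyClasses RayCircle Earring =>
      evalHom fundClass k (mainInv RayCircle Earring c)) := fun h =>
  one_ne_zero ((vee_evalHom k hk).symm.trans h.vee_eq_zero)

/-- Straightness survives composition with a homomorphism, so a straight `h` would make `d ∘ h`
straight. -/
theorem not_isStraight_mainInv : ¬ IsStraight (mainInv RayCircle Earring) := by
  rintro ⟨F, hF⟩
  obtain ⟨k, hk⟩ := exists_functional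
  exact not_isStraight_evalHom k hk
    ⟨(evalHom fundClass k).comp F, fun a => congrArg (evalHom fundClass k) (hF a)⟩

/-! ### The circle -/

/-- The one-point compactification of the ray is the circle. -/
def rayCircleHomeomorph : RayCircle ≃ₜ Circle := by
  have e1 : {x : ℝ // 0 < x} ≃ₜ ℝ := Real.expOrderIso.toHomeomorph.symm
  have e2 : OnePoint ℝ ≃ₜ Metric.sphere (0 : EuclideanSpace ℝ (Fin 2)) 1 :=
    onePointEquivSphereOfFinrankEq (by simp)
  have e3 : Metric.sphere (0 : EuclideanSpace ℝ (Fin 2)) 1 ≃ₜ Metric.sphere (0 : ℂ) 1 :=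
    Complex.orthonormalBasisOneI.repr.symm.toHomeomorph.subtype fun x => by
      rw [mem_sphere_zero_iff_norm, mem_sphere_zero_iff_norm]
      exact (congrArg (· = (1 : ℝ))
        (Complex.orthonormalBasisOneI.repr.symm.norm_map x).symm).to_iff
  exact e1.onePointCongr.trans (e2.trans e3)

/-- The inverse of `stdLoop`, rescaled to the interval `(-1, 1)`. -/
def rayCoord : RayCircle → ℝ
  -- This value is arbitrary: `∞` is not in the open cell.
  | none => 0
  | some x => (x - 1) / (x + 1)

theorem rayCoord_coe (x : {x : ℝ // 0 < x}) : rayCoord (x : RayCircle) = (x - 1) / (x + 1) := rfl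

/-- The open `1`-cell of the circle. -/
def rayCell : PartialEquiv (Fin 1 → ℝ) RayCircle where
  -- The projection only makes the map total; on the closed ball it changes nothing.
  toFun v := stdLoop (Set.projIcc 0 1 zero_le_one ((v 0 + 1) / 2))
  invFun x := fun _ => rayCoord x
  source := Metric.ball 0 1
  target := Set.range ((↑) : {x : ℝ // 0 < x} → RayCircle)
  map_source' v hv := by
    have h : |v 0| < 1 := by
      have := (norm_le_pi_norm v 0).trans_lt (mem_ball_zero_iff.1 hv)
      simpa using this
    rw [abs_lt] at h
    rw [Set.projIcc_of_mem _ (x := (v 0 + 1) / 2) ⟨by linarith, by linarith⟩,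
      stdLoop_of_mem ⟨by simp only; linarith, by simp only; linarith⟩]
    exact ⟨_, rfl⟩
  map_target' := by
    rintro _ ⟨x, rfl⟩
    have hx := x.2
    rw [mem_ball_zero_iff, pi_norm_lt_iff one_pos]
    intro _
    rw [rayCoord_coe, Real.norm_eq_abs, abs_lt, lt_div_iff₀ (by linarith),
      div_lt_iff₀ (by linarith)]
    constructor <;> linarith
  left_inv' v hv := by
    have h : |v 0| < 1 := by
      have := (norm_le_pi_norm v 0).trans_lt (mem_ball_zero_iff.1 hv)
      simpa using this
    rw [abs_lt] at h
    rw [Set.projIcc_of_mem _ (x := (v 0 + 1) / 2) ⟨by linarith, by linarith⟩,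
      stdLoop_of_mem ⟨by simp only; linarith, by simp only; linarith⟩]
    funext i
    rw [Subsingleton.elim i 0, rayCoord_coe]
    have h1 : 1 - (v 0 + 1) / 2 ≠ 0 := by linarith
    have h2 : (v 0 + 1) / 2 / (1 - (v 0 + 1) / 2) + 1 ≠ 0 := by
      have : 0 < (v 0 + 1) / 2 / (1 - (v 0 + 1) / 2) := div_pos (by linarith) (by linarith)
      linarith
    simp only
    rw [div_eq_iff h2]
    have h3 : 1 - v 0 ≠ 0 := by linarith
    have h4 : (v 0 + 1) / 2 / (1 - (v 0 + 1) / 2) = (v 0 + 1) / (1 - v 0) := by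
      rw [div_eq_div_iff h1 h3]
      ring
    rw [h4]
    field_simp
    ring
  right_inv' := by
    rintro _ ⟨x, rfl⟩
    have hx := x.2
    have hm : 0 < (rayCoord x + 1) / 2 ∧ (rayCoord x + 1) / 2 < 1 := by
      rw [rayCoord_coe]
      have h1 : ((x : ℝ) - 1) / (x + 1) + 1 = 2 * x / (x + 1) := by
        field_simp
        ring
      rw [h1]
      constructor
      · positivity
      · rw [div_lt_iff₀ two_pos, div_lt_iff₀ (by linarith)]
        linarith
    rw [Set.projIcc_of_mem _ (x := (rayCoord x + 1) / 2) ⟨hm.1.le, hm.2.le⟩,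
      stdLoop_of_mem hm]
    congr 1
    apply Subtype.ext
    simp only
    rw [div_eq_iff (by linarith [hm.2]), rayCoord_coe]
    field_simp
    ring

theorem rayCell_apply (v : Fin 1 → ℝ) :
    rayCell v = stdLoop (Set.projIcc 0 1 zero_le_one ((v 0 + 1) / 2)) := rfl

theorem rayCell_of_mem_sphere {v : Fin 1 → ℝ} (hv : v ∈ Metric.sphere 0 1) :
    rayCell v = OnePoint.infty := by
  have h : |v 0| = 1 := by
    rw [mem_sphere_zero_iff_norm] at hv
    rw [← hv, ← Real.norm_eq_abs]
    refine le_antisymm (norm_le_pi_norm v 0) ?_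
    exact (pi_norm_le_iff_of_nonneg (norm_nonneg _)).2 fun i => by rw [Subsingleton.elim i 0]
  rw [rayCell_apply, stdLoop_of_notMem]
  rintro ⟨h0, h1⟩
  rcases (abs_eq zero_le_one).1 h with h | h
  · rw [h] at h1
    norm_num at h1
  · rw [h] at h0
    norm_num at h0

theorem continuousOn_rayCell_symm : ContinuousOn rayCell.symm rayCell.target := by
  refine continuousOn_pi.2 fun _ => ?_
  change ContinuousOn rayCoord (Set.range ((↑) : {x : ℝ // 0 < x} → RayCircle))
  rw [← Set.image_univ, OnePoint.isOpenEmbedding_coe.continuousOn_image_iff,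
    continuousOn_univ]
  refine Continuous.div (by fun_prop) (by fun_prop) fun x => ?_
  have := x.2
  linarith

/-- The cells of the circle. -/
def circleCell : ℕ → Type
  | 0 => Unit
  | 1 => Unit
  | _ => Empty

/-- The characteristic maps of the circle. -/
def circleCellMap : (n : ℕ) → circleCell n → PartialEquiv (Fin n → ℝ) RayCircle
  | 0, _ => PartialEquiv.single ![] OnePoint.infty
  | 1, _ => rayCell
  | _ + 2, i => i.elim

theorem circleCellMap_zero (i : circleCell 0) (s : Set (Fin 0 → ℝ)) (hs : s.Nonempty) :
    circleCellMap 0 i '' s = {OnePoint.infty} := by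
  obtain ⟨x, hx⟩ := hs
  ext y
  constructor
  · rintro ⟨_, _, rfl⟩
    rfl
  · rintro rfl
    exact ⟨x, hx, rfl⟩

/-- There is one vertex, `∞`, and one edge, the standard loop, both of whose ends are attached to
the vertex. -/
theorem isCW_rayCircle : IsCW RayCircle := by
  let vertex : circleCell 0 := ()
  refine ⟨rayCircleHomeomorph.symm.t2Space, ⟨Topology.CWComplex.mkFinite Set.univ circleCell
    circleCellMap ?_ ?_ ?_ ?_ ?_ ?_ ?_ ?_⟩⟩
  · refine Filter.eventually_atTop.2 ⟨2, fun n hn => ?_⟩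
    obtain ⟨k, rfl⟩ := Nat.exists_eq_add_of_le' hn
    exact inferInstanceAs (IsEmpty Empty)
  · rintro (_ | _ | n)
    · exact inferInstanceAs (Finite Unit)
    · exact inferInstanceAs (Finite Unit)
    · exact inferInstanceAs (Finite Empty)
  · rintro (_ | _ | n) i
    · ext x
      rw [Subsingleton.elim x 0]
      exact iff_of_true (Subsingleton.elim (0 : Fin 0 → ℝ) _) (by simp)
    · rfl
    · exact i.elim
  · rintro (_ | _ | n) i
    · exact continuousOn_const
    · refine (stdLoop.continuous.comp (continuous_projIcc.comp ?_)).continuousOn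
      fun_prop
    · exact i.elim
  · rintro (_ | _ | n) i
    · exact continuousOn_const
    · exact continuousOn_rayCell_symm
    · exact i.elim
  · have h01 : ∀ (i : circleCell 0) (j : circleCell 1),
        Disjoint (circleCellMap 0 i '' Metric.ball 0 1) (circleCellMap 1 j '' Metric.ball 0 1) := by
      intro i j
      rw [circleCellMap_zero i _ ⟨0, by simp⟩, Set.disjoint_singleton_left]
      intro h
      rw [show circleCellMap 1 j '' Metric.ball 0 1 = rayCell.target from
        rayCell.image_source_eq_target] at h
      obtain ⟨x, hx⟩ := h
      exact OnePoint.coe_ne_infty x hx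
    rintro ⟨_ | _ | n, i⟩ _ ⟨_ | _ | m, j⟩ _ hne
    · exact absurd (by cases i; cases j; rfl) hne
    · exact h01 i j
    · exact j.elim
    · exact (h01 j i).symm
    · exact absurd (by cases i; cases j; rfl) hne
    · exact j.elim
    · exact i.elim
    · exact i.elim
    · exact i.elim
  · rintro (_ | _ | n) i
    · intro x hx
      rw [mem_sphere_zero_iff_norm, Subsingleton.elim x 0, norm_zero] at hx
      exact absurd hx zero_ne_one
    · intro x hx
      refine Set.mem_iUnion₂.2 ⟨0, Nat.zero_lt_one, Set.mem_iUnion.2 ⟨vertex, ?_⟩⟩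
      rw [circleCellMap_zero vertex (Metric.closedBall 0 1) ⟨0, by simp⟩]
      exact rayCell_of_mem_sphere hx
    · exact i.elim
  · refine Set.eq_univ_of_forall fun x => ?_
    induction x using OnePoint.rec with
    | infty =>
      refine Set.mem_iUnion₂.2 ⟨0, vertex, ?_⟩
      rw [circleCellMap_zero vertex (Metric.closedBall 0 1) ⟨0, by simp⟩]
      rfl
    | coe x =>
      refine Set.mem_iUnion₂.2 ⟨1, (), Set.image_mono Metric.ball_subset_closedBall ?_⟩
      rw [show circleCellMap 1 () '' Metric.ball 0 1 = rayCell.target from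
        rayCell.image_source_eq_target]
      exact ⟨x, rfl⟩

theorem isValid_rayCircle : IsValid RayCircle :=
  ⟨RayCircle, inferInstance, isCW_rayCircle, ⟨ContinuousMap.HomotopyEquiv.refl _⟩⟩

theorem isFinitary_rayCircle : IsFinitary RayCircle :=
  ⟨RayCircle, inferInstance, isCW_rayCircle, inferInstance, Relation.EqvGen.refl _⟩

end Straight

end

theorem mainTheorem8 :
    -- the space `X` is a circle; it is valid and finitary
    Nonempty (Straight.RayCircle ≃ₜ Circle) ∧
    Straight.IsValid Straight.RayCircle ∧
    Straight.IsFinitary Straight.RayCircle ∧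
    -- `m_*(e)` has infinite order in `H₁(Y)`, and some `k : H₁(Y) → ℚ` has `k(m_*(e)) = 1`
    (∀ n : ℕ, 0 < n → n • Straight.H1map Straight.mMap Straight.fundClass ≠ 0) ∧
    (∃ k : Straight.H1 Straight.Earring →+ ℚ,
      k (Straight.H1map Straight.mMap Straight.fundClass) = 1) ∧
    -- the relation `⋁ ⟨a_ij⟩ = 0` holds in `L(X, Y)`
    Straight.vee (fun i j => Straight.bracket (Straight.aMap i j)) = 0 ∧
    -- for each such `k`, the invariant `d ∘ h` violates this relation and is not straight
    (∀ k : Straight.H1 Straight.Earring →+ ℚ,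
      k (Straight.H1map Straight.mMap Straight.fundClass) = 1 →
      Straight.vee (fun i j => Straight.evalHom Straight.fundClass k
        (Straight.mainInv Straight.RayCircle Straight.Earring
          (Straight.cls (Straight.aMap i j)))) = 1 ∧
      ¬ Straight.IsStraight (fun c : Straight.HtpyClasses Straight.RayCircle Straight.Earring =>
        Straight.evalHom Straight.fundClass k
          (Straight.mainInv Straight.RayCircle Straight.Earring c))) ∧
    -- the main invariant is not straight
    ¬ Straight.IsStraight (Straight.mainInv Straight.RayCircle Straight.Earring) ∧
    -- so "the main invariant is always straight" fails without validity of the target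
    (¬ ∀ (X Y : Type) [TopologicalSpace X] [TopologicalSpace Y],
      Straight.IsStraight (Straight.mainInv X Y)) ∧
    -- and so does the characterization of straight invariants as the `d ∘ h`
    (¬ ∀ (X Y : Type) [TopologicalSpace X] [TopologicalSpace Y] (M : Type) [AddCommGroup M]
      (f : Straight.HtpyClasses X Y → M), Straight.IsFinitary X → Straight.IsValid X →
      (Straight.IsStraight f ↔
        ∃ d : Straight.ChainClasses X Y →+ M, ∀ c, f c = d (Straight.mainInv X Y c))) :=
  ⟨⟨Straight.rayCircleHomeomorph⟩, Straight.isValid_rayCircle, Straight.isFinitary_rayCircle,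
    Straight.nsmul_m_ne_zero, Straight.exists_functional, Straight.vee_bracket,
    fun k hk => ⟨Straight.vee_evalHom k hk, Straight.not_isStraight_evalHom k hk⟩,
    Straight.not_isStraight_mainInv, fun h => Straight.not_isStraight_mainInv (h _ _), fun h => by
      obtain ⟨k, hk⟩ := Straight.exists_functional
      exact Straight.not_isStraight_evalHom k hk
        ((h _ _ ℚ _ Straight.isFinitary_rayCircle Straight.isValid_rayCircle).2
          ⟨Straight.evalHom Straight.fundClass k, fun _ => rfl⟩)⟩
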